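/- Conventions. A convex polygon is a compact subset of $\mathbb{R}^2$ that is an intersection of finitely many closed half-planes (points and segments are allowed), and a PL set is a finite union of convex polygons. A vertex of a PL set $S$ is a point $p\in\partial S$ such that, for all sufficiently small $r>0$, the intersection of $\partial S$ with the closed Euclidean disc of radius $r$ about $p$ is not a nondegenerate straight line segment having $p$ as a point other than an endpoint (so isolated points of $S$ and free ends of segments are vertices). A PL set is generic if any two distinct vertices have different $x$-coordinates. For $\varepsilon>0$, the $\varepsilon$-pixels are the closed squares $[(i-1)\varepsilon,i\varepsilon]\times[(j-1)\varepsilon,j\varepsilon]$, $i,j\in\mathbb{Z}$, and the pixelation $P_\varepsilon(S)$ is the union of the $\varepsilon$-pixels that intersect $S$. A real number $x$ is $\varepsilon$-generic if $x\notin\varepsilon\mathbb{Z}$; then $k\varepsilon<x<(k+1)\varepsilon$ for a unique $k\in\mathbb{Z}$, and $C_\varepsilon(S,x)=P_\varepsilon(S)\cap([k\varepsilon,(k+1)\varepsilon]\times\mathbb{R})$ is the column over $x$. Let $n_{S,\varepsilon}(x)$ be the number of connected components (stacks) of $C_\varepsilon(S,x)$, let $n_S(x)$ be the number of connected components of $\{y\in\mathbb{R}:(x,y)\in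 S\}$, and let $J_S$ be the set of all $c\in\mathbb{R}$ such that $\lim_{x\nearrow c}n_S(x)\ne n_S(c)$ or $\lim_{x\searrow c}n_S(x)\neq n_S(c)$. The distance to the empty set is $+\infty$. Theorem. Let $S\subset\mathbb{R}^2$ be a generic PL set. Then there exist an integer $\nu=\nu(S)>0$ and a real number $\varepsilon_0=\varepsilon_0(S)>0$, depending only on $S$, such that, whenever $0<\varepsilon<\varepsilon_0$ and $x$ is $\varepsilon$-generic with $\operatorname{dist}(x,J_S)\ge\nu\varepsilon$, we have $$n_{S,\varepsilon}(x)=n_S(x).$$ The same equality holds, with the same $\nu$ and $\varepsilon_0$, if the column over $x$ is instead taken to be the union of those pixels of $P_\varepsilon(S)$ that intersect the vertical line through $x$. -/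

import Mathlib

open Set Filter Topology

/-! Points of the plane are pairs `(x, y) : ℝ × ℝ`. -/

/-- A closed half-plane `{(x, y) | a x + b y ≤ c}` with `(a, b) ≠ (0, 0)`. -/
def IsClosedHalfPlane (H : Set (ℝ × ℝ)) : Prop :=
  ∃ a b c : ℝ, (a, b) ≠ (0, 0) ∧ H = {q : ℝ × ℝ | a * q.1 + b * q.2 ≤ c}

/-- A convex polygon: a compact intersection of finitely many closed half-planes
(points and line segments are allowed). -/
def IsConvexPolygon (P : Set (ℝ × ℝ)) : Prop :=
  IsCompact P ∧ ∃ F : Set (Set (ℝ × ℝ)),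
    F.Finite ∧ (∀ H ∈ F, IsClosedHalfPlane H) ∧ P = ⋂₀ F

/-- A PL set: a finite union of convex polygons. -/
def IsPLSet (S : Set (ℝ × ℝ)) : Prop :=
  ∃ F : Set (Set (ℝ × ℝ)), F.Finite ∧ (∀ P ∈ F, IsConvexPolygon P) ∧ S = ⋃₀ F

/-- The closed Euclidean disc of radius `r` centred at `p` (the metric that Mathlib puts on
`ℝ × ℝ` is the sup metric, so the disc is written out). -/
def closedDisc (p : ℝ × ℝ) (r : ℝ) : Set (ℝ × ℝ) :=
  {q | (q.1 - p.1) ^ 2 + (q.2 - p.2) ^ 2 ≤ r ^ 2}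

/-- `A` is a nondegenerate straight line segment that passes through `p`, that is, `p` lies on it
and is not one of its endpoints. -/
def IsSegmentThrough (p : ℝ × ℝ) (A : Set (ℝ × ℝ)) : Prop :=
  ∃ a b : ℝ × ℝ, a ≠ b ∧ p ∈ openSegment ℝ a b ∧ A = segment ℝ a b

/-- The vertices of `S`: the boundary points `p` such that, for all sufficiently small `r > 0`, the
part of the boundary in the closed disc of radius `r` about `p` is not a segment through `p`.
Isolated points of `S` and free ends of segments are thus vertices. -/
def vertexSet (S : Set (ℝ × ℝ)) : Set (ℝ × ℝ) :=
  {p | p ∈ frontier S ∧ ∀ᶠ r in 𝓝[>] (0 : ℝ), ¬ IsSegmentThrough p (frontier S ∩ closedDisc p r)}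

/-- A generic PL set: distinct vertices have distinct `x`-coordinates. -/
def IsGenericPLSet (S : Set (ℝ × ℝ)) : Prop :=
  IsPLSet S ∧ ∀ p ∈ vertexSet S, ∀ q ∈ vertexSet S, p ≠ q → p.1 ≠ q.1

/-- The number of connected components of a subset of a topological space. -/
noncomputable def numComponents {X : Type*} [TopologicalSpace X] (A : Set X) : ℕ∞ :=
  ENat.card (ConnectedComponents A)

/-- The `ε`-pixel `[(i - 1) ε, i ε] × [(j - 1) ε, j ε]`. -/
def pixel (ε : ℝ) (i j : ℤ) : Set (ℝ × ℝ) :=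
  Icc (((i : ℝ) - 1) * ε) (i * ε) ×ˢ Icc (((j : ℝ) - 1) * ε) (j * ε)

/-- The `ε`-pixelation of `S`: the union of the `ε`-pixels that meet `S`. -/
def pixelation (ε : ℝ) (S : Set (ℝ × ℝ)) : Set (ℝ × ℝ) :=
  {q | ∃ i j : ℤ, (pixel ε i j ∩ S).Nonempty ∧ q ∈ pixel ε i j}

/-- `x` is `ε`-generic: it is not an integer multiple of `ε`. -/
def IsEpsGeneric (ε x : ℝ) : Prop :=
  ∀ k : ℤ, x ≠ k * ε

/-- The vertical strip over the interval `[k ε, (k + 1) ε]` that contains `x`. -/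
def strip (ε x : ℝ) : Set (ℝ × ℝ) :=
  {q | q.1 ∈ Icc ((⌊x / ε⌋ : ℝ) * ε) (((⌊x / ε⌋ : ℝ) + 1) * ε)}

/-- The column of the pixelation over `x`, as the part of the pixelation in the strip of `x`. -/
def column (ε : ℝ) (S : Set (ℝ × ℝ)) (x : ℝ) : Set (ℝ × ℝ) :=
  strip ε x ∩ pixelation ε S

/-- The column over `x`, as the union of those pixels of the pixelation that meet the vertical line
through `x`. It differs from `column` only in the sides of the strip, where `column` also sees
edges of pixels of the two neighbouring columns. -/
def pixelColumn (ε : ℝ) (S : Set (ℝ × ℝ)) (x : ℝ) : Set (ℝ × ℝ) :=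
  {q | ∃ i j : ℤ, (pixel ε i j ∩ S).Nonempty ∧ (pixel ε i j ∩ {p | p.1 = x}).Nonempty ∧
    q ∈ pixel ε i j}

/-- The component counter `n_S`: the number of components of the vertical slice over `x`. -/
noncomputable def componentCounter (S : Set (ℝ × ℝ)) (x : ℝ) : ℕ∞ :=
  numComponents {y : ℝ | (x, y) ∈ S}

/-- The stack counter `n_{S,ε}`: the number of components of the column over `x`. -/
noncomputable def stackCounter (ε : ℝ) (S : Set (ℝ × ℝ)) (x : ℝ) : ℕ∞ :=
  numComponents (column ε S x)

/-- The stack counter for columns understood as unions of pixels. -/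
noncomputable def pixelStackCounter (ε : ℝ) (S : Set (ℝ × ℝ)) (x : ℝ) : ℕ∞ :=
  numComponents (pixelColumn ε S x)

/-- The jumping set of `S`: the points at which the left or the right limit of the component
counter is not equal to its value. -/
def jumpingSet (S : Set (ℝ × ℝ)) : Set ℝ :=
  {c | ¬ Tendsto (componentCounter S) (𝓝[<] c) (𝓝 (componentCounter S c)) ∨
    ¬ Tendsto (componentCounter S) (𝓝[>] c) (𝓝 (componentCounter S c))}

/-!
On either side of a line `x = c`, a PL set is simple: for small `t > 0`, its fibre over `c ± t` is a
disjoint union of finitely many *bands* `[f i t, g i t]` with `f i`, `g i` affine in `t`. To see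
this, note that a polygon contributes at most one band on either side
(`IsConvexPolygon.isIntervalGerm`), that germs of affine functions at `0⁺` are totally ordered, and
that overlapping bands can be merged, so that a family with fewest members is disjoint
(`IsPLSet.exists_hasBands`).

If over a window around `x` the set splits into `m` connected pieces, connected over subintervals,
at heights that differ by at least `3 ε` (`IsStacked`), then each piece thickens to a connected
union of pixels and different pieces stay apart, so the column has `m` components, as has the fibre
over `x`. The edges that `column` inherits from the neighbouring columns do no harm: `column` is the
image of three columns of pixels under the horizontal retraction onto the strip
(`stackCounter_eq`).

It remains to find such windows near each `c`; compactness makes the constants uniform.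

* If `c` is a jump, only windows at distance at least a multiple of `ε` from `c` matter. There, the
  set consists of the bands on one side of `c`. A gap between two bands grows linearly with the
  distance from `c`, while the ends of the bands vary by `O(ε)` within a window
  (`HasBands.exists_isStacked`).
* If `c` is not a jump, then there are as many bands on either side as the fibre over `c` has
  components, and each band issues from one of these components. Two bands from the same component
  force a vertex in it, namely the lower corner of the gap between neighbouring bands
  (`HasBands.exists_vertex_of_two`); a component without a band has a vertex at its top
  (`HasBands.mem_vertexSet_of_missed`). By the count, if one of these occurs, then so does the other,
  in a different component, which contradicts genericity. So exactly one band issues from each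
  component on each side, and the gaps are bounded below near `c`
  (`IsGenericPLSet.exists_isStacked_of_notMem_jumpingSet`).
-/

/-! ### Counting components of separated unions -/

/-- A set that splits into `m` nonempty connected pieces, any two of them at distance at least
`η > 0`, has exactly `m` connected components. -/
theorem numComponents_eq_of_separated {X : Type*} [PseudoMetricSpace X] {A : Set X} {m : ℕ}
    (B : Fin m → Set X) (hA : A = ⋃ i, B i) (hne : ∀ i, (B i).Nonempty)
    (hpc : ∀ i, IsPreconnected (B i)) {η : ℝ} (hη : 0 < η)
    (hsep : ∀ i j, i ≠ j → ∀ p ∈ B i, ∀ q ∈ B j, η ≤ dist p q) :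
    numComponents A = m := by
  have hex : ∀ p : A, ∃ i, (p : X) ∈ B i := fun p => by
    have : (p : X) ∈ ⋃ i, B i := hA ▸ p.2
    simpa using this
  choose ι hι using hex
  have huniq : ∀ (p q : A) (i : Fin m), (q : X) ∈ B i → dist p q < η → ι p = i := by
    intro p q i hq hd
    by_contra h
    exact absurd (hsep _ _ h _ (hι p) _ hq) (not_le.2 hd)
  have hcont : Continuous ι := by
    refine (IsLocallyConstant.iff_eventually_eq ι).2 (fun p => ?_) |>.continuous
    filter_upwards [Metric.ball_mem_nhds p hη] with q hq
    exact huniq q p _ (hι p) hq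
  have hself : ∀ (p : A) (i : Fin m), (p : X) ∈ B i → ι p = i := fun p i hp =>
    huniq p p i hp (by simpa using hη)
  have hbij : Function.Bijective hcont.connectedComponentsLift := by
    constructor
    · intro x y
      obtain ⟨p, rfl⟩ := ConnectedComponents.surjective_coe x
      obtain ⟨q, rfl⟩ := ConnectedComponents.surjective_coe y
      intro h
      simp only [Continuous.connectedComponentsLift_apply_coe] at h
      have hpre : IsPreconnected ((↑) ⁻¹' B (ι q) : Set A) := by
        rw [← IsInducing.subtypeVal.isPreconnected_image, Subtype.image_preimage_coe,
          inter_eq_right.2]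
        · exact hpc _
        · rw [hA]
          exact subset_iUnion B _
      rw [ConnectedComponents.coe_eq_coe']
      exact hpre.subset_connectedComponent (hι q) (by simpa [← h] using hι p)
    · intro i
      obtain ⟨b, hb⟩ := hne i
      have hbA : b ∈ A := by rw [hA]; exact mem_iUnion.2 ⟨i, hb⟩
      exact ⟨((⟨b, hbA⟩ : A) : ConnectedComponents A), by simpa using hself ⟨b, hbA⟩ i hb⟩
  rw [numComponents, ENat.card_congr (Equiv.ofBijective _ hbij)]
  simp

/-- The set `S` is stacked over `[lo, hi]`: its part over this interval splits into `m` pieces, each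
of which is nonempty and connected over every subinterval, and the heights of points of different
pieces differ by at least `η`. -/
def IsStacked (S : Set (ℝ × ℝ)) (m : ℕ) (lo hi η : ℝ) : Prop :=
  ∃ B : Fin m → Set (ℝ × ℝ), S ∩ {r | r.1 ∈ Icc lo hi} = ⋃ i, B i ∧
    (∀ i p q, lo ≤ p → p ≤ q → q ≤ hi → (B i ∩ {r | r.1 ∈ Icc p q}).Nonempty ∧
      IsPreconnected (B i ∩ {r | r.1 ∈ Icc p q})) ∧
    ∀ i j, i ≠ j → ∀ p ∈ B i, ∀ q ∈ B j, η ≤ dist p.2 q.2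

theorem inter_strip_inter_strip (B : Set (ℝ × ℝ)) {lo hi p q : ℝ} (hp : lo ≤ p) (hq : q ≤ hi) :
    B ∩ {r | r.1 ∈ Icc lo hi} ∩ {r | r.1 ∈ Icc p q} = B ∩ {r | r.1 ∈ Icc p q} := by
  rw [inter_assoc]
  congr 1
  exact inter_eq_right.2 fun r hr => Icc_subset_Icc hp hq hr

theorem IsStacked.mono {S : Set (ℝ × ℝ)} {m : ℕ} {lo hi η lo' hi' : ℝ}
    (h : IsStacked S m lo hi η) (hlo : lo ≤ lo') (hhi : hi' ≤ hi) :
    IsStacked S m lo' hi' η := by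
  obtain ⟨B, hB, hc, hs⟩ := h
  refine ⟨fun i => B i ∩ {r | r.1 ∈ Icc lo' hi'}, ?_, ?_, ?_⟩
  · rw [← iUnion_inter, ← hB, inter_assoc]
    congr 1
    refine Eq.symm (inter_eq_right.2 fun r hr => ?_)
    exact Icc_subset_Icc hlo hhi hr
  · intro i p q hp hpq hq
    rw [inter_strip_inter_strip _ hp hq]
    exact hc i p q (by linarith) hpq (by linarith)
  · exact fun i j hij p hp q hq => hs i j hij p hp.1 q hq.1

theorem IsStacked.componentCounter_eq {S : Set (ℝ × ℝ)} {m : ℕ} {x η : ℝ} (hη : 0 < η)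
    (h : IsStacked S m x x η) : componentCounter S x = m := by
  obtain ⟨B, hB, hc, hs⟩ := h
  have hBx : ∀ i, B i ∩ {r | r.1 ∈ Icc x x} = B i := fun i => by
    rw [inter_eq_left]
    intro r hr
    have : r ∈ ⋃ i, B i := mem_iUnion.2 ⟨i, hr⟩
    rw [← hB] at this
    exact this.2
  have hc' := fun i => hc i x x le_rfl le_rfl le_rfl
  simp only [hBx] at hc'
  refine numComponents_eq_of_separated (fun i => Prod.snd '' B i) ?_
    (fun i => (hc' i).1.image _) (fun i => (hc' i).2.image _ continuous_snd.continuousOn) hη ?_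
  · rw [← image_iUnion, ← hB]
    ext y
    constructor
    · intro hy
      exact ⟨(x, y), ⟨hy, by simp⟩, rfl⟩
    · rintro ⟨⟨u, v⟩, ⟨h1, h2⟩, rfl⟩
      simp only [Icc_self, mem_ofPred_eq, mem_singleton_iff] at h2
      subst h2
      exact h1
  · rintro i j hij _ ⟨p, hp, rfl⟩ _ ⟨q, hq, rfl⟩
    exact hs i j hij p hp q hq

/-! ### Pixelating a stacked set -/

theorem isPreconnected_iUnion_of_cover {X ι : Type*} [TopologicalSpace X] {B : Set X}
    (hB : IsPreconnected B) (hne : B.Nonempty) (Q : ι → Set X) (hQ : ∀ a, IsPreconnected (Q a))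
    (hm : ∀ a, (Q a ∩ B).Nonempty) (hcov : B ⊆ ⋃ a, Q a) : IsPreconnected (⋃ a, Q a) := by
  obtain ⟨b, hb⟩ := hne
  have : ⋃ a, Q a = ⋃₀ (insert B (range fun a => B ∪ Q a)) := by
    ext z
    constructor
    · intro hz
      obtain ⟨a, ha⟩ := mem_iUnion.1 hz
      exact ⟨B ∪ Q a, mem_insert_of_mem _ ⟨a, rfl⟩, Or.inr ha⟩
    · rintro ⟨T, hT, hz⟩
      rcases hT with rfl | ⟨a, rfl⟩
      · exact hcov hz
      · rcases hz with hz | hz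
        · exact hcov hz
        · exact mem_iUnion.2 ⟨a, hz⟩
  rw [this]
  refine isPreconnected_sUnion b _ ?_ ?_
  · rintro T (rfl | ⟨a, rfl⟩)
    · exact hb
    · exact Or.inl hb
  · rintro T (rfl | ⟨a, rfl⟩)
    · exact hB
    · obtain ⟨z, hz1, hz2⟩ := hm a
      exact hB.union z hz2 hz1 (hQ a)

theorem isPreconnected_pixel (ε : ℝ) (i j : ℤ) : IsPreconnected (pixel ε i j) :=
  isPreconnected_Icc.prod isPreconnected_Icc

/-- Every point whose abscissa lies in the columns `a, …, b` lies in a pixel of these columns. -/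
theorem exists_mem_pixel {ε : ℝ} (hε : 0 < ε) {a b : ℤ} (hab : a ≤ b) {p : ℝ × ℝ}
    (h1 : ((a : ℝ) - 1) * ε ≤ p.1) (h2 : p.1 ≤ b * ε) :
    ∃ i j : ℤ, a ≤ i ∧ i ≤ b ∧ p ∈ pixel ε i j := by
  have key : ∀ z : ℝ, (((⌈z / ε⌉ : ℤ) : ℝ) - 1) * ε ≤ z ∧ z ≤ (⌈z / ε⌉ : ℤ) * ε := by
    intro z
    have hz := Int.ceil_lt_add_one (z / ε)
    have hz' := Int.le_ceil (z / ε)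
    constructor
    · rw [← le_div_iff₀ hε]; linarith
    · rwa [← div_le_iff₀ hε]
  by_cases h : p.1 ≤ a * ε
  · exact ⟨a, ⌈p.2 / ε⌉, le_rfl, hab, ⟨h1, h⟩, key p.2⟩
  · refine ⟨⌈p.1 / ε⌉, ⌈p.2 / ε⌉, ?_, ?_, key p.1, key p.2⟩
    · have : (a : ℝ) < p.1 / ε := by rw [lt_div_iff₀ hε]; linarith
      exact_mod_cast (this.trans_le (Int.le_ceil _)).le
    · rw [Int.ceil_le, div_le_iff₀ hε]; exact h2

/-- If `S` is stacked over the columns `a, …, b` with gaps at least `3 ε`, then the pixels of these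
columns that meet `S` form `m` components, and this persists under horizontal continuous maps. -/
theorem IsStacked.numComponents_image {S : Set (ℝ × ℝ)} {m : ℕ} {ε : ℝ} (hε : 0 < ε) {a b : ℤ}
    (hab : a ≤ b) (h : IsStacked S m (((a : ℝ) - 1) * ε) (b * ε) (3 * ε)) (φ : ℝ × ℝ → ℝ × ℝ)
    (hφ : Continuous φ) (hsnd : ∀ p, (φ p).2 = p.2) :
    numComponents (φ '' {q | ∃ i j : ℤ, a ≤ i ∧ i ≤ b ∧ (pixel ε i j ∩ S).Nonempty ∧
      q ∈ pixel ε i j}) = m := by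
  obtain ⟨B, hB, hc, hs⟩ := h
  have hle : ((a : ℝ) - 1) * ε ≤ b * ε := by
    have : (a : ℝ) ≤ b := by exact_mod_cast hab
    nlinarith
  have hBs : ∀ i, B i ⊆ S ∩ {r | r.1 ∈ Icc (((a : ℝ) - 1) * ε) (b * ε)} := fun i => by
    rw [hB]; exact subset_iUnion B i
  have hBx : ∀ i, B i ∩ {r | r.1 ∈ Icc (((a : ℝ) - 1) * ε) (b * ε)} = B i := fun i =>
    inter_eq_left.2 fun r hr => (hBs i hr).2
  have hc' := fun i => hc i _ _ le_rfl hle le_rfl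
  simp only [hBx] at hc'
  let I (n : Fin m) : Type := {ij : ℤ × ℤ // a ≤ ij.1 ∧ ij.1 ≤ b ∧
    (pixel ε ij.1 ij.2 ∩ B n).Nonempty}
  refine numComponents_eq_of_separated
    (fun n => φ '' ⋃ ij : I n, pixel ε ij.1.1 ij.1.2) ?_ ?_ ?_ hε ?_
  · rw [← image_iUnion]
    congr 1
    ext q
    simp only [mem_ofPred_eq, mem_iUnion]
    constructor
    · rintro ⟨i, j, hi1, hi2, ⟨r, hr1, hr2⟩, hq⟩
      have hr : r ∈ ⋃ i, B i := by
        rw [← hB]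
        refine ⟨hr2, hr1.1.1.trans' ?_, hr1.1.2.trans ?_⟩
        · have : (a : ℝ) ≤ i := by exact_mod_cast hi1
          gcongr
        · have : (i : ℝ) ≤ b := by exact_mod_cast hi2
          gcongr
      obtain ⟨n, hn⟩ := mem_iUnion.1 hr
      exact ⟨n, ⟨(i, j), hi1, hi2, r, hr1, hn⟩, hq⟩
    · rintro ⟨n, ⟨⟨i, j⟩, hi1, hi2, r, hr1, hr2⟩, hq⟩
      exact ⟨i, j, hi1, hi2, ⟨r, hr1, (hBs n hr2).1⟩, hq⟩
  · intro n
    obtain ⟨r, hr⟩ := (hc' n).1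
    obtain ⟨i, j, h1, h2, h3⟩ := exists_mem_pixel hε hab (hBs n hr).2.1 (hBs n hr).2.2
    exact ⟨φ r, r, mem_iUnion.2 ⟨⟨(i, j), h1, h2, r, h3, hr⟩, h3⟩, rfl⟩
  · intro n
    refine IsPreconnected.image ?_ _ hφ.continuousOn
    refine isPreconnected_iUnion_of_cover (hc' n).2 (hc' n).1 _
      (fun ij => isPreconnected_pixel _ _ _) (fun ij => ij.2.2.2) ?_
    intro r hr
    obtain ⟨i, j, h1, h2, h3⟩ := exists_mem_pixel hε hab (hBs n hr).2.1 (hBs n hr).2.2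
    exact mem_iUnion.2 ⟨⟨(i, j), h1, h2, r, h3, hr⟩, h3⟩
  · rintro n n' hn _ ⟨p, hp, rfl⟩ _ ⟨q, hq, rfl⟩
    obtain ⟨ij, hpx⟩ := mem_iUnion.1 hp
    obtain ⟨r, hr1, hr2⟩ := ij.2.2.2
    obtain ⟨ij', hqx⟩ := mem_iUnion.1 hq
    obtain ⟨r', hr1', hr2'⟩ := ij'.2.2.2
    have h3 := hs n n' hn r hr2 r' hr2'
    have e1 : dist r.2 p.2 ≤ ε := (Real.dist_le_of_mem_Icc hr1.2 hpx.2).trans (by simp; linarith)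
    have e2 : dist q.2 r'.2 ≤ ε := (Real.dist_le_of_mem_Icc hqx.2 hr1'.2).trans (by simp; linarith)
    have e3 : dist p.2 q.2 ≤ dist (φ p) (φ q) := by
      rw [← hsnd p, ← hsnd q, Prod.dist_eq]
      exact le_max_right _ _
    have e4 := dist_triangle4 r.2 p.2 q.2 r'.2
    linarith

/-- The two inequalities that locate an `ε`-generic number between consecutive multiples. -/
theorem IsEpsGeneric.floor_bounds {ε x : ℝ} (hε : 0 < ε) (hx : IsEpsGeneric ε x) :
    (⌊x / ε⌋ : ℝ) * ε < x ∧ x < ((⌊x / ε⌋ : ℝ) + 1) * ε := by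
  constructor
  · refine lt_of_le_of_ne ?_ (hx _).symm
    rw [← le_div_iff₀ hε]; exact Int.floor_le _
  · rw [← div_lt_iff₀ hε]; exact Int.lt_floor_add_one _

theorem pixelStackCounter_eq {S : Set (ℝ × ℝ)} {m : ℕ} {ε x : ℝ} (hε : 0 < ε)
    (hx : IsEpsGeneric ε x) (h : IsStacked S m (x - 2 * ε) (x + 2 * ε) (3 * ε)) :
    pixelStackCounter ε S x = m := by
  obtain ⟨h1, h2⟩ := hx.floor_bounds hε
  set k := ⌊x / ε⌋
  have h' : IsStacked S m ((((k + 1 : ℤ) : ℝ) - 1) * ε) (((k + 1 : ℤ) : ℝ) * ε) (3 * ε) :=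
    h.mono (by push_cast; linarith) (by push_cast; linarith)
  rw [← h'.numComponents_image hε le_rfl id continuous_id fun _ => rfl, image_id,
    pixelStackCounter]
  congr 1
  ext q
  constructor
  · rintro ⟨i, j, hS, ⟨r, hr, rfl⟩, hq⟩
    have hi : i = k + 1 := by
      have e1 : ((i : ℝ) - 1) < k + 1 := by
        have := hr.1.1.trans_lt h2
        exact lt_of_mul_lt_mul_right this hε.le
      have e2 : (k : ℝ) < i := by
        have := h1.trans_le hr.1.2
        exact lt_of_mul_lt_mul_right this hε.le
      have e1' : i - 1 < k + 1 := by exact_mod_cast e1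
      have e2' : k < i := by exact_mod_cast e2
      omega
    exact ⟨i, j, hi.ge, hi.le, hS, hq⟩
  · rintro ⟨i, j, hi1, hi2, hS, hq⟩
    obtain rfl : i = k + 1 := le_antisymm hi2 hi1
    refine ⟨k + 1, j, hS, ⟨(x, q.2), ⟨⟨?_, ?_⟩, hq.2⟩, rfl⟩, hq⟩
    · push_cast; linarith
    · push_cast; linarith

/-- The extra edges in `column` come from the two neighbouring columns of pixels: `column` is the
image of three columns of pixels under the horizontal retraction onto the strip. -/
theorem stackCounter_eq {S : Set (ℝ × ℝ)} {m : ℕ} {ε x : ℝ} (hε : 0 < ε)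
    (hx : IsEpsGeneric ε x) (h : IsStacked S m (x - 2 * ε) (x + 2 * ε) (3 * ε)) :
    stackCounter ε S x = m := by
  obtain ⟨h1, h2⟩ := hx.floor_bounds hε
  have h' : IsStacked S m (((⌊x / ε⌋ : ℝ) - 1) * ε) (((⌊x / ε⌋ + 2 : ℤ) : ℝ) * ε) (3 * ε) :=
    h.mono (by linarith) (by push_cast; linarith)
  rw [← h'.numComponents_image hε (by omega)
    (fun p => (max ((⌊x / ε⌋ : ℝ) * ε) (min (((⌊x / ε⌋ : ℝ) + 1) * ε) p.1), p.2))
    (by fun_prop) fun _ => rfl, stackCounter]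
  congr 1
  rw [column, strip]
  generalize ⌊x / ε⌋ = k at *
  have hk : (k : ℝ) * ε ≤ (k + 1) * ε := by linarith
  ext q
  constructor
  · rintro ⟨hq, i, j, hS, hqi⟩
    have e1 : ((i : ℝ) - 1) ≤ k + 1 := le_of_mul_le_mul_right (hqi.1.1.trans hq.2) hε
    have e2 : (k : ℝ) ≤ i := le_of_mul_le_mul_right (hq.1.trans hqi.1.2) hε
    have e1' : i - 1 ≤ k + 1 := by exact_mod_cast e1
    have e2' : k ≤ i := by exact_mod_cast e2
    refine ⟨q, ⟨i, j, e2', by omega, hS, hqi⟩, ?_⟩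
    ext
    · simp only
      rw [min_eq_right hq.2, max_eq_right hq.1]
    · rfl
  · rintro ⟨p, ⟨i, j, hi1, hi2, hS, hp⟩, rfl⟩
    refine ⟨⟨le_max_left _ _, max_le hk (min_le_left _ _)⟩, i, j, hS, ?_, hp.2⟩
    have hi1' : (k : ℝ) ≤ i := by exact_mod_cast hi1
    have hi2' : (i : ℝ) ≤ k + 2 := by exact_mod_cast hi2
    constructor
    · refine le_max_of_le_right (le_min ?_ hp.1.1)
      have : (i : ℝ) - 1 ≤ k + 1 := by linarith
      gcongr
    · exact max_le (by gcongr) ((min_le_right _ _).trans hp.1.2)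

/-! ### Germs of fibres of PL sets -/

/-- The affine function of `t` with value `p.1` at `0` and slope `p.2`. -/
def aff (p : ℝ × ℝ) (t : ℝ) : ℝ := p.1 + p.2 * t

@[fun_prop]
theorem continuous_aff (p : ℝ × ℝ) : Continuous (aff p) := by
  unfold aff; fun_prop

/-- Germs of affine functions at `0` from the right are totally ordered. -/
theorem aff_le_or_lt (p q : ℝ × ℝ) :
    (∀ᶠ t in 𝓝[>] (0 : ℝ), aff p t ≤ aff q t) ∨ ∀ᶠ t in 𝓝[>] (0 : ℝ), aff q t < aff p t := by
  have key : ∀ p q : ℝ × ℝ, p.1 < q.1 → ∀ᶠ t in 𝓝[>] (0 : ℝ), aff p t < aff q t := by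
    intro p q h
    refine eventually_nhdsWithin_of_eventually_nhds ?_
    exact (continuous_aff p).continuousAt.eventually_lt (continuous_aff q).continuousAt
      (by simpa [aff] using h)
  rcases lt_trichotomy p.1 q.1 with h | h | h
  · exact Or.inl ((key p q h).mono fun _ => le_of_lt)
  · rcases le_or_gt p.2 q.2 with h' | h'
    · left
      filter_upwards [self_mem_nhdsWithin] with t ht
      have : (0 : ℝ) < t := ht
      unfold aff
      rw [h]
      gcongr
    · right
      filter_upwards [self_mem_nhdsWithin] with t ht
      have : (0 : ℝ) < t := ht
      unfold aff
      rw [h]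
      gcongr
  · exact Or.inr (key q p h)

theorem exists_aff_min (p q : ℝ × ℝ) :
    ∃ r, ∀ᶠ t in 𝓝[>] (0 : ℝ), aff r t = min (aff p t) (aff q t) := by
  rcases aff_le_or_lt p q with h | h
  · exact ⟨p, h.mono fun t ht => (min_eq_left ht).symm⟩
  · exact ⟨q, h.mono fun t ht => (min_eq_right ht.le).symm⟩

theorem exists_aff_max (p q : ℝ × ℝ) :
    ∃ r, ∀ᶠ t in 𝓝[>] (0 : ℝ), aff r t = max (aff p t) (aff q t) := by
  rcases aff_le_or_lt p q with h | h
  · exact ⟨q, h.mono fun t ht => (max_eq_right ht).symm⟩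
  · exact ⟨p, h.mono fun t ht => (max_eq_left ht.le).symm⟩

/-- Along the ray `t ↦ c + σ t`, the fibres of `P` are germwise empty or intervals with affine
ends. -/
def IsIntervalGerm (P : Set (ℝ × ℝ)) (c σ : ℝ) : Prop :=
  (∀ᶠ t in 𝓝[>] (0 : ℝ), ∀ y, (c + σ * t, y) ∉ P) ∨
    ∃ f g : ℝ × ℝ, ∀ᶠ t in 𝓝[>] (0 : ℝ), aff f t ≤ aff g t ∧
      ∀ y, (c + σ * t, y) ∈ P ↔ aff f t ≤ y ∧ y ≤ aff g t

theorem isIntervalGerm_of_fiber {P : Set (ℝ × ℝ)} {c σ : ℝ} (f g : ℝ × ℝ)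
    (h : ∀ᶠ t in 𝓝[>] (0 : ℝ), ∀ y, (c + σ * t, y) ∈ P ↔ aff f t ≤ y ∧ y ≤ aff g t) :
    IsIntervalGerm P c σ := by
  rcases aff_le_or_lt f g with h' | h'
  · right
    exact ⟨f, g, h'.and h⟩
  · left
    filter_upwards [h, h'] with t h1 h2 y hy
    have := (h1 y).1 hy
    linarith

theorem IsIntervalGerm.inter_halfPlane {P H : Set (ℝ × ℝ)} {c σ : ℝ} (hP : IsIntervalGerm P c σ)
    (hH : IsClosedHalfPlane H) : IsIntervalGerm (H ∩ P) c σ := by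
  rcases hP with hP | ⟨f, g, hfg⟩
  · exact Or.inl (hP.mono fun t ht y hy => ht y hy.2)
  obtain ⟨a, b, d, -, rfl⟩ := hH
  rcases lt_trichotomy b 0 with hb | rfl | hb
  · obtain ⟨r, hr⟩ := exists_aff_max f ((d - a * c) / b, -(a * σ) / b)
    refine isIntervalGerm_of_fiber r g ?_
    filter_upwards [hfg, hr] with t h1 h2 y
    have e : aff ((d - a * c) / b, -(a * σ) / b) t = (d - a * (c + σ * t)) / b := by
      unfold aff; field_simp; ring
    rw [h2, max_le_iff, e, mem_inter_iff, h1.2, mem_ofPred_eq, div_le_iff_of_neg hb]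
    constructor
    · rintro ⟨h3, h4, h5⟩; exact ⟨⟨h4, by linarith⟩, h5⟩
    · rintro ⟨⟨h4, h3⟩, h5⟩; exact ⟨by linarith, h4, h5⟩
  · rcases aff_le_or_lt (a * c, a * σ) (d, 0) with h | h
    · refine isIntervalGerm_of_fiber f g ?_
      filter_upwards [hfg, h] with t h1 h2 y
      rw [← h1.2, mem_inter_iff, and_iff_right_iff_imp]
      intro _
      simp only [aff] at h2
      simp only [mem_ofPred_eq]
      linarith
    · left
      filter_upwards [h] with t h2 y hy
      have := hy.1
      simp only [aff] at h2
      simp only [mem_ofPred_eq] at this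
      linarith
  · obtain ⟨r, hr⟩ := exists_aff_min g ((d - a * c) / b, -(a * σ) / b)
    refine isIntervalGerm_of_fiber f r ?_
    filter_upwards [hfg, hr] with t h1 h2 y
    have e : aff ((d - a * c) / b, -(a * σ) / b) t = (d - a * (c + σ * t)) / b := by
      unfold aff; field_simp; ring
    rw [h2, le_min_iff, e, mem_inter_iff, h1.2, mem_ofPred_eq, le_div_iff₀ hb]
    constructor
    · rintro ⟨h3, h4, h5⟩; exact ⟨h4, h5, by linarith⟩
    · rintro ⟨h4, h5, h3⟩; exact ⟨by linarith, h4, h5⟩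

theorem IsConvexPolygon.isIntervalGerm {P : Set (ℝ × ℝ)} (hP : IsConvexPolygon P) (c σ : ℝ) :
    IsIntervalGerm P c σ := by
  obtain ⟨hc, F, hF, hH, rfl⟩ := hP
  obtain ⟨R, hR⟩ := hc.isBounded.exists_norm_le
  -- Adding a bounding horizontal strip keeps the fibres bounded throughout the induction.
  have hbox : ⋂₀ F = ⋂₀ F ∩ {q | -R ≤ q.2 ∧ q.2 ≤ R} := by
    refine (inter_eq_left.2 fun q hq => ?_).symm
    exact abs_le.1 ((norm_snd_le q).trans (hR q hq))
  rw [hbox]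
  clear hbox hR hc
  induction F, hF using Set.Finite.induction_on with
  | empty =>
    refine isIntervalGerm_of_fiber (-R, 0) (R, 0) (Eventually.of_forall fun t y => ?_)
    simp [aff]
  | @insert H F _ _ ih =>
    rw [sInter_insert, inter_assoc]
    exact (ih fun H' h' => hH H' (mem_insert_of_mem _ h')).inter_halfPlane
      (hH H (mem_insert _ _))

/-- The finite family `s` of pairs of affine functions describes the fibres of `S` along the ray
`t ↦ c + σ t`. -/
def IsBandFamily (S : Set (ℝ × ℝ)) (c σ : ℝ) (s : Finset ((ℝ × ℝ) × (ℝ × ℝ))) : Prop :=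
  ∀ᶠ t in 𝓝[>] (0 : ℝ), (∀ p ∈ s, aff p.1 t ≤ aff p.2 t) ∧
    ∀ y, (c + σ * t, y) ∈ S ↔ ∃ p ∈ s, aff p.1 t ≤ y ∧ y ≤ aff p.2 t

theorem IsPLSet.exists_isBandFamily {S : Set (ℝ × ℝ)} (hS : IsPLSet S) (c σ : ℝ) :
    ∃ s, IsBandFamily S c σ s := by
  classical
  obtain ⟨F, hF, hP, rfl⟩ := hS
  induction F, hF using Set.Finite.induction_on with
  | empty => exact ⟨∅, Eventually.of_forall fun t => by simp⟩
  | @insert P F _ _ ih =>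
    obtain ⟨s, hs⟩ := ih fun P' h' => hP P' (mem_insert_of_mem _ h')
    rw [sUnion_insert]
    rcases (hP P (mem_insert _ _)).isIntervalGerm c σ with h | ⟨f, g, h⟩
    · refine ⟨s, ?_⟩
      filter_upwards [hs, h] with t h1 h2
      refine ⟨h1.1, fun y => ?_⟩
      rw [← h1.2, mem_union, or_iff_right (h2 y)]
    · refine ⟨insert (f, g) s, ?_⟩
      filter_upwards [hs, h] with t h1 h2
      refine ⟨fun p hp => ?_, fun y => ?_⟩
      · rcases Finset.mem_insert.1 hp with rfl | hp
        · exact h2.1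
        · exact h1.1 p hp
      · rw [mem_union, h1.2, h2.2]
        simp

/-- Overlapping bands of a family can be merged; so a family with fewest members consists of
disjoint bands. -/
theorem IsPLSet.exists_disjoint_isBandFamily {S : Set (ℝ × ℝ)} (hS : IsPLSet S) (c σ : ℝ) :
    ∃ s, IsBandFamily S c σ s ∧ ∀ p ∈ s, ∀ q ∈ s, p ≠ q →
      (∀ᶠ t in 𝓝[>] (0 : ℝ), aff p.2 t < aff q.1 t) ∨
        ∀ᶠ t in 𝓝[>] (0 : ℝ), aff q.2 t < aff p.1 t := by
  classical
  have hex : ∃ n, ∃ s, IsBandFamily S c σ s ∧ s.card = n := by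
    obtain ⟨s, hs⟩ := hS.exists_isBandFamily c σ
    exact ⟨_, s, hs, rfl⟩
  obtain ⟨s, hs, hcard⟩ := Nat.find_spec hex
  refine ⟨s, hs, fun p hp q hq hpq => ?_⟩
  rcases aff_le_or_lt q.1 p.2 with h1 | h1
  swap
  · exact Or.inl h1
  rcases aff_le_or_lt p.1 q.2 with h2 | h2
  swap
  · exact Or.inr h2
  exfalso
  obtain ⟨f, hf⟩ := exists_aff_min p.1 q.1
  obtain ⟨g, hg⟩ := exists_aff_max p.2 q.2
  have hnew : IsBandFamily S c σ (insert (f, g) ((s.erase p).erase q)) := by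
    filter_upwards [hs, h1, h2, hf, hg] with t hs h1 h2 hf hg
    have hp' := hs.1 p hp
    have hq' := hs.1 q hq
    refine ⟨fun r hr => ?_, fun y => ?_⟩
    · rcases Finset.mem_insert.1 hr with rfl | hr
      · rw [hf, hg]
        exact (min_le_left _ _).trans (hp'.trans (le_max_left _ _))
      · exact hs.1 r (Finset.mem_of_mem_erase (Finset.mem_of_mem_erase hr))
    · rw [hs.2]
      constructor
      · rintro ⟨r, hr, hy1, hy2⟩
        by_cases hrp : r = p ∨ r = q
        · refine ⟨(f, g), Finset.mem_insert_self _ _, ?_, ?_⟩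
          · rw [hf]
            rcases hrp with rfl | rfl
            · exact (min_le_left _ _).trans hy1
            · exact (min_le_right _ _).trans hy1
          · rw [hg]
            rcases hrp with rfl | rfl
            · exact hy2.trans (le_max_left _ _)
            · exact hy2.trans (le_max_right _ _)
        · push Not at hrp
          exact ⟨r, by simp [hrp, hr], hy1, hy2⟩
      · rintro ⟨r, hr, hy1, hy2⟩
        rcases Finset.mem_insert.1 hr with rfl | hr
        · simp only [hf, hg, min_le_iff, le_max_iff] at hy1 hy2
          by_cases hyp : aff p.1 t ≤ y ∧ y ≤ aff p.2 t
          · exact ⟨p, hp, hyp⟩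
          · refine ⟨q, hq, ?_⟩
            by_contra hyq
            grind
        · exact ⟨r, Finset.mem_of_mem_erase (Finset.mem_of_mem_erase hr), hy1, hy2⟩
  have hlt : (insert (f, g) ((s.erase p).erase q)).card < Nat.find hex := by
    rw [← hcard]
    have e1 := Finset.card_insert_le (f, g) ((s.erase p).erase q)
    have e2 : ((s.erase p).erase q).card + 1 = (s.erase p).card :=
      Finset.card_erase_add_one (by simp [hpq.symm, hq])
    have e3 := Finset.card_erase_add_one hp
    omega
  exact Nat.find_min hex hlt ⟨_, hnew, rfl⟩

/-- Over the part `0 < t < δ` of the ray `t ↦ c + σ t`, the fibres of `S` are the disjoint unions of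
the `n` intervals `[f i, g i]` with affine ends. -/
structure HasBands (S : Set (ℝ × ℝ)) (c σ δ : ℝ) {n : ℕ} (f g : Fin n → ℝ × ℝ) : Prop where
  mem_iff : ∀ t ∈ Ioo 0 δ, ∀ y, (c + σ * t, y) ∈ S ↔ ∃ i, y ∈ Icc (aff (f i) t) (aff (g i) t)
  le : ∀ t ∈ Ioo 0 δ, ∀ i, aff (f i) t ≤ aff (g i) t
  lt_or_lt : ∀ i j, i ≠ j → (∀ t ∈ Ioo 0 δ, aff (g i) t < aff (f j) t) ∨
    ∀ t ∈ Ioo 0 δ, aff (g j) t < aff (f i) t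

theorem HasBands.mono {S : Set (ℝ × ℝ)} {c σ δ δ' : ℝ} {n : ℕ} {f g : Fin n → ℝ × ℝ}
    (h : HasBands S c σ δ f g) (hδ : δ' ≤ δ) : HasBands S c σ δ' f g where
  mem_iff t ht := h.mem_iff t (Ioo_subset_Ioo_right hδ ht)
  le t ht := h.le t (Ioo_subset_Ioo_right hδ ht)
  lt_or_lt i j hij := (h.lt_or_lt i j hij).imp (fun h t ht => h t (Ioo_subset_Ioo_right hδ ht))
    (fun h t ht => h t (Ioo_subset_Ioo_right hδ ht))

theorem IsPLSet.exists_hasBands {S : Set (ℝ × ℝ)} (hS : IsPLSet S) (c σ : ℝ) :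
    ∃ (n : ℕ) (f g : Fin n → ℝ × ℝ), ∃ δ > 0, HasBands S c σ δ f g := by
  obtain ⟨s, hs, hd⟩ := hS.exists_disjoint_isBandFamily c σ
  let e : Fin s.card ≃ s := s.equivFin.symm
  have hd' : ∀ i j : Fin s.card, ∀ᶠ δ in 𝓝[>] (0 : ℝ), i ≠ j →
      (∀ t ∈ Ioo 0 δ, aff (e i).1.2 t < aff (e j).1.1 t) ∨
        ∀ t ∈ Ioo 0 δ, aff (e j).1.2 t < aff (e i).1.1 t := by
    intro i j
    by_cases hij : i = j
    · simp [hij]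
    have hev : ∀ {p : ℝ → Prop}, (∀ᶠ t in 𝓝[>] (0 : ℝ), p t) →
        ∀ᶠ δ in 𝓝[>] (0 : ℝ), ∀ t ∈ Ioo 0 δ, p t := by
      intro p hp
      obtain ⟨u, hu, hup⟩ := mem_nhdsGT_iff_exists_Ioo_subset.1 hp
      filter_upwards [Ioo_mem_nhdsGT hu] with δ hδ t ht
      exact hup ⟨ht.1, ht.2.trans hδ.2⟩
    rcases hd _ (e i).2 _ (e j).2 (fun h => hij (e.injective (Subtype.ext h))) with h | h
    · exact (hev h).mono fun δ h _ => Or.inl h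
    · exact (hev h).mono fun δ h _ => Or.inr h
  obtain ⟨u, hu, hup⟩ := mem_nhdsGT_iff_exists_Ioo_subset.1 hs
  have hall := (eventually_all.2 fun i => eventually_all.2 (hd' i)).and (Ioo_mem_nhdsGT hu)
  obtain ⟨δ, hδ, hδu⟩ := hall.exists
  refine ⟨s.card, fun i => (e i).1.1, fun i => (e i).1.2, δ, hδu.1, ?_, ?_, hδ⟩
  · intro t ht y
    rw [(hup ⟨ht.1, ht.2.trans hδu.2⟩).2 y]
    constructor
    · rintro ⟨p, hp, hy⟩
      exact ⟨e.symm ⟨p, hp⟩, by simpa using hy⟩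
    · rintro ⟨i, hi⟩
      exact ⟨_, (e i).2, hi⟩
  · intro t ht i
    exact (hup ⟨ht.1, ht.2.trans hδu.2⟩).1 _ (e i).2

/-! ### Vertices on a vertical line -/

theorem IsPLSet.isCompact {S : Set (ℝ × ℝ)} (hS : IsPLSet S) : IsCompact S := by
  obtain ⟨F, hF, hP, rfl⟩ := hS
  exact hF.isCompact_sUnion fun P hPF => (hP P hPF).1

theorem mem_frontier_of_tendsto {X ι : Type*} [TopologicalSpace X] {S : Set X} {p : X}
    (hp : p ∈ S) {l : Filter ι} [l.NeBot] {u : ι → X} (hu : Tendsto u l (𝓝 p))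
    (hS : ∀ᶠ i in l, u i ∉ S) : p ∈ frontier S := by
  rw [frontier_eq_closure_inter_closure]
  exact ⟨subset_closure hp, mem_closure_of_tendsto hu hS⟩

/-- A point of a closed set is a vertex if, locally, nothing of the set lies on one side of the
vertical line through it, and nothing lies above it on this line. -/
theorem mem_vertexSet_of_top {S : Set (ℝ × ℝ)} (hS : IsClosed S) {c b σ r₀ : ℝ}
    (hσ : σ * σ = 1) (hr₀ : 0 < r₀) (hp : (c, b) ∈ S)
    (h1 : ∀ t ∈ Ioo 0 r₀, ∀ y, |y - b| < r₀ → (c + σ * t, y) ∉ S)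
    (h2 : ∀ y, b < y → y < b + r₀ → (c, y) ∉ S) : (c, b) ∈ vertexSet S := by
  refine ⟨mem_frontier_of_tendsto hp (l := 𝓝[>] (0 : ℝ)) (u := fun t => (c + σ * t, b)) ?_ ?_, ?_⟩
  · have : Tendsto (fun t : ℝ => (c + σ * t, b)) (𝓝 0) (𝓝 (c + σ * 0, b)) :=
      Continuous.tendsto (by fun_prop) 0
    simpa using this.mono_left nhdsWithin_le_nhds
  · filter_upwards [Ioo_mem_nhdsGT hr₀] with t ht
    exact h1 t ht b (by simpa using hr₀)
  · filter_upwards [Ioo_mem_nhdsGT hr₀] with r hr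
    rintro ⟨u, v, huv, ⟨α, β, hα, hβ, hαβ, hpuv⟩, hA⟩
    have key : ∀ w ∈ segment ℝ u v, σ * (w.1 - c) ≤ 0 ∧ (w.1 = c → w.2 ≤ b) := by
      intro w hw
      rw [← hA] at hw
      have hwS := hS.frontier_subset hw.1
      have hd : (w.1 - c) ^ 2 + (w.2 - b) ^ 2 ≤ r ^ 2 := hw.2
      have hw2 : |w.2 - b| < r₀ :=
        (abs_le_of_sq_le_sq (by nlinarith [sq_nonneg (w.1 - c)]) hr.1.le).trans_lt hr.2
      constructor
      · by_contra! hpos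
        have ht : σ * (w.1 - c) ≤ r := by
          refine (abs_le.1 (abs_le_of_sq_le_sq (?_ : (σ * (w.1 - c)) ^ 2 ≤ r ^ 2) hr.1.le)).2
          have : (σ * (w.1 - c)) ^ 2 = (w.1 - c) ^ 2 := by
            linear_combination (w.1 - c) ^ 2 * hσ
          nlinarith [sq_nonneg (w.2 - b)]
        refine h1 (σ * (w.1 - c)) ⟨hpos, ht.trans_lt hr.2⟩ w.2 hw2 ?_
        have : c + σ * (σ * (w.1 - c)) = w.1 := by linear_combination (w.1 - c) * hσ
        rwa [this]
      · intro hwc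
        by_contra! hlt
        refine h2 w.2 hlt (by linarith [(abs_lt.1 hw2).2]) ?_
        rwa [← hwc]
    obtain ⟨hu1, hu2⟩ := key u (left_mem_segment ℝ u v)
    obtain ⟨hv1, hv2⟩ := key v (right_mem_segment ℝ u v)
    have e1 : α * u.1 + β * v.1 = c := congrArg Prod.fst hpuv
    have e2 : α * u.2 + β * v.2 = b := congrArg Prod.snd hpuv
    -- A convex combination of two non-positive numbers vanishes only if both do.
    have zero : ∀ p q : ℝ, p ≤ 0 → q ≤ 0 → α * p + β * q = 0 → p = 0 ∧ q = 0 := by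
      intro p q hp hq h
      have h3 : α * p ≤ 0 := mul_nonpos_of_nonneg_of_nonpos hα.le hp
      have h4 : β * q ≤ 0 := mul_nonpos_of_nonneg_of_nonpos hβ.le hq
      have h5 : α * p = 0 := by linarith
      have h6 : β * q = 0 := by linarith
      exact ⟨(mul_eq_zero.1 h5).resolve_left hα.ne', (mul_eq_zero.1 h6).resolve_left hβ.ne'⟩
    have hσ0 : σ ≠ 0 := by rintro rfl; simp at hσ
    obtain ⟨h3, h4⟩ := zero _ _ hu1 hv1 (by linear_combination σ * e1 - σ * c * hαβ)
    have huc : u.1 = c := by linarith [(mul_eq_zero.1 h3).resolve_left hσ0]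
    have hvc : v.1 = c := by linarith [(mul_eq_zero.1 h4).resolve_left hσ0]
    obtain ⟨h5, h6⟩ := zero (u.2 - b) (v.2 - b) (by linarith [hu2 huc]) (by linarith [hv2 hvc])
      (by linear_combination e2 - b * hαβ)
    exact huv (Prod.ext (huc.trans hvc.symm) (by linarith))

/-- A point from which two non-parallel segments run inside the frontier is a vertex. -/
theorem mem_vertexSet_of_two_rays {S : Set (ℝ × ℝ)} {p d₁ d₂ : ℝ × ℝ}
    (hd : d₁.1 * d₂.2 - d₁.2 * d₂.1 ≠ 0) {r₀ : ℝ} (hr₀ : 0 < r₀)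
    (h1 : ∀ t ∈ Ioo 0 r₀, p + t • d₁ ∈ frontier S) (h2 : ∀ t ∈ Ioo 0 r₀, p + t • d₂ ∈ frontier S) :
    p ∈ vertexSet S := by
  have htend : ∀ d : ℝ × ℝ, Tendsto (fun t : ℝ => p + t • d) (𝓝[>] 0) (𝓝 p) := by
    intro d
    have : Tendsto (fun t : ℝ => p + t • d) (𝓝 0) (𝓝 (p + (0 : ℝ) • d)) :=
      Continuous.tendsto (by fun_prop) 0
    simpa using this.mono_left nhdsWithin_le_nhds
  refine ⟨isClosed_frontier.mem_of_tendsto (htend d₁)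
    (by filter_upwards [Ioo_mem_nhdsGT hr₀] using h1), ?_⟩
  filter_upwards [self_mem_nhdsWithin] with r (hr : 0 < r)
  rintro ⟨u, v, huv, hp, hA⟩
  have hdisc : closedDisc p r ∈ 𝓝 p := by
    have hcont : Continuous fun q : ℝ × ℝ => (q.1 - p.1) ^ 2 + (q.2 - p.2) ^ 2 := by fun_prop
    refine hcont.continuousAt.preimage_mem_nhds (Iic_mem_nhds ?_)
    have : 0 < r ^ 2 := by positivity
    simpa using this
  have hIoo : ∀ᶠ t in 𝓝[>] (0 : ℝ), t ∈ Ioo 0 r₀ := Ioo_mem_nhdsGT hr₀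
  obtain ⟨t, ht, ht1, ht2⟩ := (hIoo.and
    (((htend d₁).eventually_mem hdisc).and ((htend d₂).eventually_mem hdisc))).exists
  have hw1 : p + t • d₁ ∈ segment ℝ u v := hA ▸ ⟨h1 t ht, ht1⟩
  have hw2 : p + t • d₂ ∈ segment ℝ u v := hA ▸ ⟨h2 t ht, ht2⟩
  have hp' := openSegment_subset_segment ℝ u v hp
  rw [segment_eq_image'] at hw1 hw2 hp'
  obtain ⟨x, -, hx⟩ := hw1
  obtain ⟨y, -, hy⟩ := hw2
  obtain ⟨z, -, hz⟩ := hp'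
  simp only [Prod.ext_iff, Prod.fst_add, Prod.snd_add, Prod.smul_fst, Prod.smul_snd,
    Prod.fst_sub, Prod.snd_sub, smul_eq_mul] at hx hy hz
  have e1 : t * d₁.1 = (x - z) * (v.1 - u.1) := by linear_combination hz.1 - hx.1
  have e2 : t * d₁.2 = (x - z) * (v.2 - u.2) := by linear_combination hz.2 - hx.2
  have e3 : t * d₂.1 = (y - z) * (v.1 - u.1) := by linear_combination hz.1 - hy.1
  have e4 : t * d₂.2 = (y - z) * (v.2 - u.2) := by linear_combination hz.2 - hy.2
  have : t * t * (d₁.1 * d₂.2 - d₁.2 * d₂.1) = 0 := by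
    have : t * t * (d₁.1 * d₂.2 - d₁.2 * d₂.1) = t * d₁.1 * (t * d₂.2) - t * d₁.2 * (t * d₂.1) := by
      ring
    rw [this, e1, e2, e3, e4]
    ring
  exact hd ((mul_eq_zero.1 this).resolve_left (mul_pos ht.1 ht.1).ne')

/-! ### Bands and the components of a fibre -/

/-- The fibre of `S` over `c` is the disjoint union of the `m` intervals `[a k, b k]`. -/
structure HasFiber (S : Set (ℝ × ℝ)) (c : ℝ) {m : ℕ} (a b : Fin m → ℝ) : Prop where
  mem_iff : ∀ y, (c, y) ∈ S ↔ ∃ k, y ∈ Icc (a k) (b k)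
  le : ∀ k, a k ≤ b k
  lt_or_lt : ∀ k l, k ≠ l → b k < a l ∨ b l < a k

theorem HasBands.hasFiber {S : Set (ℝ × ℝ)} {c σ δ : ℝ} {n : ℕ} {f g : Fin n → ℝ × ℝ}
    (h : HasBands S c σ δ f g) {t : ℝ} (ht : t ∈ Ioo 0 δ) :
    HasFiber S (c + σ * t) (fun i => aff (f i) t) (fun i => aff (g i) t) where
  mem_iff := h.mem_iff t ht
  le := h.le t ht
  lt_or_lt i j hij := (h.lt_or_lt i j hij).imp (fun h => h t ht) (fun h => h t ht)

theorem IsPLSet.exists_hasFiber {S : Set (ℝ × ℝ)} (hS : IsPLSet S) (c : ℝ) :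
    ∃ (m : ℕ) (a b : Fin m → ℝ), HasFiber S c a b := by
  obtain ⟨n, f, g, δ, hδ, h⟩ := hS.exists_hasBands c 0
  have := h.hasFiber (t := δ / 2) ⟨by linarith, by linarith⟩
  rw [zero_mul, add_zero] at this
  exact ⟨_, _, _, this⟩

theorem HasFiber.exists_gap {S : Set (ℝ × ℝ)} {c : ℝ} {m : ℕ} {a b : Fin m → ℝ}
    (h : HasFiber S c a b) : ∃ η > 0, ∀ k l, k ≠ l → b k + η ≤ a l ∨ b l + η ≤ a k := by
  have : ∀ k l : Fin m, ∀ᶠ η in 𝓝[>] (0 : ℝ), k ≠ l → b k + η ≤ a l ∨ b l + η ≤ a k := by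
    intro k l
    by_cases hkl : k = l
    · simp [hkl]
    rcases h.lt_or_lt k l hkl with h | h
    · filter_upwards [Ioo_mem_nhdsGT (sub_pos.2 h)] with η hη _
      exact Or.inl (by linarith [hη.2])
    · filter_upwards [Ioo_mem_nhdsGT (sub_pos.2 h)] with η hη _
      exact Or.inr (by linarith [hη.2])
  obtain ⟨η, hη, hη0⟩ :=
    ((eventually_all.2 fun k => eventually_all.2 (this k)).and self_mem_nhdsWithin).exists
  exact ⟨η, hη0, hη⟩

theorem HasFiber.componentCounter_eq {S : Set (ℝ × ℝ)} {c : ℝ} {m : ℕ} {a b : Fin m → ℝ}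
    (h : HasFiber S c a b) : componentCounter S c = m := by
  obtain ⟨η, hη, hgap⟩ := h.exists_gap
  refine numComponents_eq_of_separated (fun k => Icc (a k) (b k)) ?_
    (fun k => nonempty_Icc.2 (h.le k)) (fun k => isPreconnected_Icc) hη ?_
  · ext y
    simpa using h.mem_iff y
  · intro k l hkl y hy z hz
    rw [Real.dist_eq]
    rcases hgap k l hkl with h | h
    · rw [abs_sub_comm]
      exact le_trans (by linarith [hy.2, hz.1]) (le_abs_self _)
    · exact le_trans (by linarith [hy.1, hz.2]) (le_abs_self _)

/-- An interval inside a fibre stays in one component of the fibre. -/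
theorem HasFiber.mem_of_Icc_subset {S : Set (ℝ × ℝ)} {c : ℝ} {m : ℕ} {a b : Fin m → ℝ}
    (h : HasFiber S c a b) {u w : ℝ} {k : Fin m} (hu : u ∈ Icc (a k) (b k)) (huw : u ≤ w)
    (hsub : ∀ y ∈ Icc u w, (c, y) ∈ S) : w ∈ Icc (a k) (b k) := by
  refine ⟨hu.1.trans huw, ?_⟩
  by_contra! hw
  obtain ⟨η, hη, hgap⟩ := h.exists_gap
  -- Points just above `b k` belong to no component.
  have hlt : b k < min w (b k + η / 2) := lt_min hw (by linarith)
  obtain ⟨l, hl⟩ := (h.mem_iff _).1 (hsub (min w (b k + η / 2))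
    ⟨hu.2.trans hlt.le, min_le_left _ _⟩)
  have hle := min_le_right w (b k + η / 2)
  have hkl : k ≠ l := by
    rintro rfl
    linarith [hl.2]
  rcases hgap k l hkl with h1 | h1
  · linarith [hl.1]
  · linarith [hl.2, h.le k]

theorem fst_le_of_aff_le {p q : ℝ × ℝ} {δ : ℝ} (hδ : 0 < δ)
    (h : ∀ t ∈ Ioo 0 δ, aff p t ≤ aff q t) : p.1 ≤ q.1 := by
  have hp : ∀ p : ℝ × ℝ, Tendsto (aff p) (𝓝[>] 0) (𝓝 p.1) := fun p => by
    have := ((continuous_aff p).tendsto 0).mono_left (nhdsWithin_le_nhds (s := Ioi 0))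
    simpa [aff] using this
  refine le_of_tendsto_of_tendsto (hp p) (hp q) ?_
  filter_upwards [Ioo_mem_nhdsGT hδ] using h

theorem HasBands.mem_of_mem_limit {S : Set (ℝ × ℝ)} (hS : IsClosed S) {c σ δ : ℝ} {n : ℕ}
    {f g : Fin n → ℝ × ℝ} (h : HasBands S c σ δ f g) (hδ : 0 < δ) {i : Fin n} {y : ℝ}
    (hy : y ∈ Icc (f i).1 (g i).1) : (c, y) ∈ S := by
  have hy' : y ∈ segment ℝ (f i).1 (g i).1 := by rwa [segment_eq_Icc (hy.1.trans hy.2)]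
  obtain ⟨α, β, hα, hβ, hαβ, rfl⟩ := hy'
  have : Tendsto (fun t => (c + σ * t, α * aff (f i) t + β * aff (g i) t)) (𝓝[>] (0 : ℝ))
      (𝓝 (c, α • (f i).1 + β • (g i).1)) := by
    have : Tendsto (fun t => (c + σ * t, α * aff (f i) t + β * aff (g i) t)) (𝓝 (0 : ℝ))
        (𝓝 (c + σ * 0, α * aff (f i) 0 + β * aff (g i) 0)) :=
      Continuous.tendsto (by fun_prop) 0
    simpa [aff] using this.mono_left nhdsWithin_le_nhds
  refine hS.mem_of_tendsto this ?_
  filter_upwards [Ioo_mem_nhdsGT hδ] with t ht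
  refine (h.mem_iff t ht _).2 ⟨i, ?_⟩
  rw [← segment_eq_Icc (h.le t ht i)]
  exact ⟨α, β, hα, hβ, hαβ, rfl⟩

/-- Every band issues from a component of the limiting fibre. -/
theorem HasBands.exists_component {S : Set (ℝ × ℝ)} (hS : IsClosed S) {c σ δ : ℝ} {n m : ℕ}
    {f g : Fin n → ℝ × ℝ} (h : HasBands S c σ δ f g) (hδ : 0 < δ) {a b : Fin m → ℝ}
    (hK : HasFiber S c a b) (i : Fin n) :
    ∃ k, (f i).1 ∈ Icc (a k) (b k) ∧ (g i).1 ∈ Icc (a k) (b k) := by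
  have hle : (f i).1 ≤ (g i).1 := fst_le_of_aff_le hδ fun t ht => h.le t ht i
  have hmem : ∀ y ∈ Icc (f i).1 (g i).1, (c, y) ∈ S := fun y hy => h.mem_of_mem_limit hS hδ hy
  obtain ⟨k, hk⟩ := (hK.mem_iff _).1 (hmem _ ⟨le_rfl, hle⟩)
  exact ⟨k, hk, hK.mem_of_Icc_subset hk hle hmem⟩

/-- The frontier contains those ends of a gap in a vertical line that belong to the set. -/
theorem mem_frontier_of_gap {S : Set (ℝ × ℝ)} {x u w : ℝ} (huw : u < w)
    (hgap : ∀ y ∈ Ioo u w, (x, y) ∉ S) :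
    ((x, u) ∈ S → (x, u) ∈ frontier S) ∧ ((x, w) ∈ S → (x, w) ∈ frontier S) := by
  constructor
  · intro hu
    refine mem_frontier_of_tendsto hu (l := 𝓝[>] u) (u := fun y => (x, y)) ?_ ?_
    · exact (Continuous.tendsto (by fun_prop) u).mono_left nhdsWithin_le_nhds
    · filter_upwards [Ioo_mem_nhdsGT huw] using hgap
  · intro hw
    refine mem_frontier_of_tendsto hw (l := 𝓝[<] w) (u := fun y => (x, y)) ?_ ?_
    · exact (Continuous.tendsto (by fun_prop) w).mono_left nhdsWithin_le_nhds
    · filter_upwards [Ioo_mem_nhdsLT huw] using hgap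

/-- Two bands that issue from the same component of the fibre on the same side force a vertex in
this component: the lower corner of the gap between two neighbouring bands. -/
theorem HasBands.exists_vertex_of_two {S : Set (ℝ × ℝ)} {c σ δ : ℝ}
    (hσ : σ ≠ 0) {n m : ℕ} {f g : Fin n → ℝ × ℝ} (h : HasBands S c σ δ f g) (hδ : 0 < δ)
    {a b : Fin m → ℝ} (hK : HasFiber S c a b) {k : Fin m} {i j : Fin n} (hij : i ≠ j)
    (hi : (f i).1 ∈ Icc (a k) (b k) ∧ (g i).1 ∈ Icc (a k) (b k))
    (hj : (f j).1 ∈ Icc (a k) (b k) ∧ (g j).1 ∈ Icc (a k) (b k)) :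
    ∃ y ∈ Icc (a k) (b k), (c, y) ∈ vertexSet S := by
  classical
  wlog hlt : ∀ t ∈ Ioo 0 δ, aff (g i) t < aff (f j) t generalizing i j
  · exact this hij.symm hj hi ((h.lt_or_lt i j hij).resolve_left hlt)
  have hmid : δ / 2 ∈ Ioo 0 δ := ⟨by linarith, by linarith⟩
  -- Replace `j` by the lowest band above the band `i` that issues from the component `k`.
  obtain ⟨l, hl, hmin⟩ := Finset.exists_min_image
    (Finset.univ.filter fun l => (∀ t ∈ Ioo 0 δ, aff (g i) t < aff (f l) t) ∧
      (f l).1 ∈ Icc (a k) (b k)) (fun l => aff (f l) (δ / 2))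
    ⟨j, Finset.mem_filter.2 ⟨Finset.mem_univ _, hlt, hj.1⟩⟩
  simp only [Finset.mem_filter, Finset.mem_univ, true_and] at hl hmin
  obtain ⟨hil, hlk⟩ := hl
  have hgap : ∀ t ∈ Ioo 0 δ, ∀ y ∈ Ioo (aff (g i) t) (aff (f l) t), (c + σ * t, y) ∉ S := by
    intro t ht y hy hyS
    obtain ⟨o, ho⟩ := (h.mem_iff t ht y).1 hyS
    have hoi : i ≠ o := by rintro rfl; linarith [ho.2, hy.1]
    have hol : o ≠ l := by rintro rfl; linarith [ho.1, hy.2]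
    have h1 : ∀ t ∈ Ioo 0 δ, aff (g i) t < aff (f o) t := by
      refine (h.lt_or_lt i o hoi).resolve_right fun h2 => ?_
      linarith [h2 t ht, ho.2, hy.1, h.le t ht i]
    have h2 : ∀ t ∈ Ioo 0 δ, aff (g o) t < aff (f l) t := by
      refine (h.lt_or_lt o l hol).resolve_right fun h2 => ?_
      linarith [h2 t ht, ho.1, hy.2, h.le t ht l]
    have h3 : (f o).1 ∈ Icc (a k) (b k) := by
      constructor
      · exact hi.2.1.trans (fst_le_of_aff_le hδ fun t ht => (h1 t ht).le)
      · exact (fst_le_of_aff_le hδ fun t ht => (h.le t ht o).trans (h2 t ht).le).trans hlk.2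
    have h4 := hmin o ⟨h1, h3⟩
    linarith [h2 _ hmid, h.le _ hmid o]
  have hle : (g i).1 ≤ (f l).1 := fst_le_of_aff_le hδ fun t ht => (hil t ht).le
  have hfr : ∀ t ∈ Ioo 0 δ, (c + σ * t, aff (g i) t) ∈ frontier S ∧
      (c + σ * t, aff (f l) t) ∈ frontier S := fun t ht =>
    ⟨(mem_frontier_of_gap (hil t ht) (hgap t ht)).1
        ((h.mem_iff t ht _).2 ⟨i, h.le t ht i, le_rfl⟩),
      (mem_frontier_of_gap (hil t ht) (hgap t ht)).2
        ((h.mem_iff t ht _).2 ⟨l, le_rfl, h.le t ht l⟩)⟩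
  refine ⟨(g i).1, hi.2, ?_⟩
  rcases hle.eq_or_lt with heq | hlt'
  · -- The gap is a wedge with apex at the vertex.
    have hslope : (g i).2 ≠ (f l).2 := by
      intro hs
      have := hil _ hmid
      rw [Prod.ext heq hs] at this
      exact lt_irrefl _ this
    refine mem_vertexSet_of_two_rays (d₁ := (σ, (g i).2)) (d₂ := (σ, (f l).2)) ?_ hδ ?_ ?_
    · simp only
      have : σ * (f l).2 - (g i).2 * σ = σ * ((f l).2 - (g i).2) := by ring
      rw [this]
      exact mul_ne_zero hσ (sub_ne_zero.2 hslope.symm)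
    · intro t ht
      convert (hfr t ht).1 using 1
      ext <;> simp [aff] <;> ring
    · intro t ht
      convert (hfr t ht).2 using 1
      ext <;> simp [aff, heq] <;> ring
  · -- The gap is bounded by a vertical segment of the fibre.
    refine mem_vertexSet_of_two_rays (d₁ := (σ, (g i).2)) (d₂ := (0, 1)) (by simpa using hσ)
      (lt_min hδ (sub_pos.2 hlt')) ?_ ?_
    · intro t ht
      convert (hfr t ⟨ht.1, ht.2.trans_le (min_le_left _ _)⟩).1 using 1
      ext <;> simp [aff] <;> ring
    · intro τ hτ
      have hτ2 : τ < (f l).1 - (g i).1 := hτ.2.trans_le (min_le_right _ _)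
      have e : ((c, (g i).1) : ℝ × ℝ) + τ • ((0, 1) : ℝ × ℝ) = (c, (g i).1 + τ) := by
        ext <;> simp
      rw [e]
      refine mem_frontier_of_tendsto ((hK.mem_iff _).2 ⟨k, ?_, ?_⟩) (l := 𝓝[>] (0 : ℝ))
        (u := fun t => (c + σ * t, (g i).1 + τ)) ?_ ?_
      · linarith [hi.2.1, hτ.1]
      · linarith [hlk.2]
      · have : Tendsto (fun t : ℝ => (c + σ * t, (g i).1 + τ)) (𝓝 0)
            (𝓝 (c + σ * 0, (g i).1 + τ)) := Continuous.tendsto (by fun_prop) 0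
        simpa using this.mono_left nhdsWithin_le_nhds
      · have h1 : ∀ᶠ t in 𝓝[>] (0 : ℝ), aff (g i) t < (g i).1 + τ :=
          eventually_nhdsWithin_of_eventually_nhds
            ((continuous_aff _).continuousAt.eventually_lt_const (by simpa [aff] using hτ.1))
        have h2 : ∀ᶠ t in 𝓝[>] (0 : ℝ), (g i).1 + τ < aff (f l) t :=
          eventually_nhdsWithin_of_eventually_nhds
            ((continuous_aff _).continuousAt.eventually_const_lt (by simp [aff]; linarith))
        filter_upwards [h1, h2, Ioo_mem_nhdsGT hδ] with t h1 h2 ht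
        exact hgap t ht _ ⟨h1, h2⟩

theorem exists_slope_bound {n : ℕ} (f g : Fin n → ℝ × ℝ) :
    ∃ L > 0, ∀ i, |(f i).2| ≤ L ∧ |(g i).2| ≤ L := by
  obtain ⟨M, hM⟩ := Finite.exists_le fun i => |(f i).2|
  obtain ⟨N, hN⟩ := Finite.exists_le fun i => |(g i).2|
  exact ⟨max 1 (max M N), by positivity, fun i =>
    ⟨(hM i).trans (by simp), (hN i).trans (by simp)⟩⟩

theorem abs_aff_sub_aff_le {p : ℝ × ℝ} {L s t : ℝ} (hL : |p.2| ≤ L) :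
    |aff p t - aff p s| ≤ L * |t - s| := by
  have : aff p t - aff p s = p.2 * (t - s) := by unfold aff; ring
  rw [this, abs_mul]
  gcongr

/-- The top point of a component of the fibre from which no band issues is a vertex. -/
theorem HasBands.mem_vertexSet_of_missed {S : Set (ℝ × ℝ)} (hS : IsClosed S) {c σ δ : ℝ}
    (hσ : σ * σ = 1) {n m : ℕ} {f g : Fin n → ℝ × ℝ} (h : HasBands S c σ δ f g) (hδ : 0 < δ)
    {a b : Fin m → ℝ} (hK : HasFiber S c a b) {k : Fin m}
    (hk : ∀ i, ¬ ((f i).1 ∈ Icc (a k) (b k) ∧ (g i).1 ∈ Icc (a k) (b k))) :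
    (c, b k) ∈ vertexSet S := by
  obtain ⟨η, hη, hgap⟩ := hK.exists_gap
  obtain ⟨L, hL, hfg⟩ := exists_slope_bound f g
  have hr₀ : 0 < min δ (min (η / 4) (η / (4 * L))) := by positivity
  refine mem_vertexSet_of_top hS hσ hr₀ ((hK.mem_iff _).2 ⟨k, hK.le k, le_rfl⟩) ?_ ?_
  · intro t ht y hy hyS
    have ht1 : t < δ := ht.2.trans_le (min_le_left _ _)
    have ht2 : t < η / (4 * L) :=
      ht.2.trans_le ((min_le_right _ _).trans (min_le_right _ _))
    have hy' : |y - b k| < η / 4 := hy.trans_le ((min_le_right _ _).trans (min_le_left _ _))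
    have ht3 : L * |t - 0| ≤ η / 4 := by
      rw [sub_zero, abs_of_pos ht.1]
      rw [lt_div_iff₀ (by positivity)] at ht2
      linarith
    obtain ⟨i, hi⟩ := (h.mem_iff t ⟨ht.1, ht1⟩ y).1 hyS
    obtain ⟨l, hl⟩ := h.exists_component hS hδ hK i
    have hkl : k ≠ l := by rintro rfl; exact hk i hl
    have h1 := abs_le.1 ((abs_aff_sub_aff_le (s := 0) (t := t) (hfg i).1).trans ht3)
    have h2 := abs_le.1 ((abs_aff_sub_aff_le (s := 0) (t := t) (hfg i).2).trans ht3)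
    have e : ∀ p : ℝ × ℝ, aff p 0 = p.1 := fun p => by simp [aff]
    rw [e] at h1 h2
    have hy'' := abs_lt.1 hy'
    rcases hgap k l hkl with h3 | h3
    · linarith [hi.1, hl.1.1]
    · linarith [hi.2, hl.2.2, hK.le k]
  · intro y hy1 hy2 hyS
    have hle : min δ (min (η / 4) (η / (4 * L))) ≤ η / 4 :=
      (min_le_right _ _).trans (min_le_left _ _)
    obtain ⟨l, hl⟩ := (hK.mem_iff y).1 hyS
    have hkl : k ≠ l := by rintro rfl; linarith [hl.2]
    rcases hgap k l hkl with h3 | h3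
    · linarith [hl.1]
    · linarith [hl.2, hK.le k]

/-! ### The structure of a generic set near a vertical line -/

/-- Near a line `x = c` that is not in the jumping set, on either side exactly one band issues from
each component of the fibre over `c`. -/
theorem IsGenericPLSet.exists_bands_of_notMem_jumpingSet {S : Set (ℝ × ℝ)} (hS : IsGenericPLSet S)
    {c σ : ℝ} (hσ : σ = 1 ∨ σ = -1) (hc : c ∉ jumpingSet S) {m : ℕ} {a b : Fin m → ℝ}
    (hK : HasFiber S c a b) :
    ∃ (f g : Fin m → ℝ × ℝ), ∃ δ > 0, HasBands S c σ δ f g ∧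
      ∀ k, (f k).1 ∈ Icc (a k) (b k) ∧ (g k).1 ∈ Icc (a k) (b k) := by
  have hcl := hS.1.isCompact.isClosed
  have hσσ : σ * σ = 1 := by rcases hσ with rfl | rfl <;> norm_num
  have hσ0 : σ ≠ 0 := by rintro rfl; simp at hσσ
  obtain ⟨n, f, g, δ, hδ, h⟩ := hS.1.exists_hasBands c σ
  -- The component counter is continuous at `c`, hence eventually constant on both sides.
  have hev : ∀ᶠ t in 𝓝[>] (0 : ℝ), componentCounter S (c + σ * t) = m := by
    have hcont : Tendsto (fun t : ℝ => c + σ * t) (𝓝[>] 0) (𝓝 c) := by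
      have : Tendsto (fun t : ℝ => c + σ * t) (𝓝 0) (𝓝 (c + σ * 0)) :=
        Continuous.tendsto (by fun_prop) 0
      simpa using this.mono_left nhdsWithin_le_nhds
    rw [jumpingSet, mem_ofPred_eq, not_or, not_not, not_not, hK.componentCounter_eq,
      ENat.nhds_natCast, tendsto_pure, tendsto_pure] at hc
    rcases hσ with rfl | rfl
    · refine (tendsto_nhdsWithin_iff.2 ⟨hcont, ?_⟩).eventually hc.2
      filter_upwards [self_mem_nhdsWithin] with t (ht : 0 < t)
      simpa using ht
    · refine (tendsto_nhdsWithin_iff.2 ⟨hcont, ?_⟩).eventually hc.1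
      filter_upwards [self_mem_nhdsWithin] with t (ht : 0 < t)
      simpa using ht
  have hIoo : ∀ᶠ t in 𝓝[>] (0 : ℝ), t ∈ Ioo 0 δ := Ioo_mem_nhdsGT hδ
  obtain ⟨t, ht1, ht2⟩ := (hev.and hIoo).exists
  rw [(h.hasFiber ht2).componentCounter_eq] at ht1
  obtain rfl : n = m := by exact_mod_cast ht1
  choose φ hφ using h.exists_component hcl hδ hK
  have huniq : ∀ k l y, y ∈ Icc (a k) (b k) → y ∈ Icc (a l) (b l) → k = l := by
    intro k l y hk hl
    by_contra hkl
    rcases hK.lt_or_lt k l hkl with h | h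
    · linarith [hk.2, hl.1]
    · linarith [hk.1, hl.2]
  have hinj : Function.Injective φ := by
    by_contra hninj
    -- As many bands as components: if two bands share a component, another component is missed,
    -- and the two components contain vertices over the same abscissa.
    have hnsurj : ¬ Function.Surjective φ := fun hs => hninj (Finite.injective_iff_surjective.2 hs)
    simp only [Function.Injective, not_forall] at hninj
    obtain ⟨i, j, hφij, hij⟩ := hninj
    simp only [Function.Surjective, not_forall, not_exists] at hnsurj
    obtain ⟨l, hl⟩ := hnsurj
    obtain ⟨y, hy, hyv⟩ := h.exists_vertex_of_two hσ0 hδ hK hij (hφ i) (hφij ▸ hφ j)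
    have hlv := h.mem_vertexSet_of_missed hcl hσσ hδ hK (k := l) fun i' hi' =>
      hl i' (huniq _ _ _ (hφ i').1 hi'.1)
    refine hS.2 _ hyv _ hlv ?_ rfl
    intro heq
    rw [Prod.mk.injEq] at heq
    exact hl i (huniq _ _ y hy (by rw [heq.2]; exact ⟨hK.le l, le_rfl⟩))
  let e := Equiv.ofBijective φ (Finite.injective_iff_bijective.1 hinj)
  refine ⟨fun k => f (e.symm k), fun k => g (e.symm k), δ, hδ, ⟨?_, ?_, ?_⟩, ?_⟩
  · intro t ht y
    rw [h.mem_iff t ht, ← e.symm.exists_congr_right]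
  · exact fun t ht k => h.le t ht _
  · exact fun i j hij => h.lt_or_lt _ _ (e.symm.injective.ne hij)
  · intro k
    have h1 := hφ (e.symm k)
    have h2 : φ (e.symm k) = k := e.apply_symm_apply k
    rwa [h2] at h1

/-- The closed region between the graphs of two affine functions over the half-line from `c` in the
direction `σ = ±1`. -/
def bandSet (c σ : ℝ) (f g : ℝ × ℝ) : Set (ℝ × ℝ) :=
  {r | 0 ≤ σ * (r.1 - c) ∧ aff f (σ * (r.1 - c)) ≤ r.2 ∧ r.2 ≤ aff g (σ * (r.1 - c))}

theorem convex_bandSet (c σ : ℝ) (f g : ℝ × ℝ) : Convex ℝ (bandSet c σ f g) := by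
  rintro x ⟨hx1, hx2, hx3⟩ y ⟨hy1, hy2, hy3⟩ α β hα hβ hαβ
  obtain rfl : α = 1 - β := by linarith
  have h1 := add_nonneg (mul_nonneg hα hx1) (mul_nonneg hβ hy1)
  have h2 := add_nonneg (mul_nonneg hα (sub_nonneg.2 hx2)) (mul_nonneg hβ (sub_nonneg.2 hy2))
  have h3 := add_nonneg (mul_nonneg hα (sub_nonneg.2 hx3)) (mul_nonneg hβ (sub_nonneg.2 hy3))
  simp only [aff] at h1 h2 h3
  refine ⟨?_, ?_, ?_⟩ <;> simp only [aff, Prod.fst_add, Prod.snd_add, Prod.smul_fst,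
    Prod.smul_snd, smul_eq_mul] <;> linarith

theorem isPreconnected_bandSet_inter (c σ : ℝ) (f g : ℝ × ℝ) (p q : ℝ) :
    IsPreconnected (bandSet c σ f g ∩ {r | r.1 ∈ Icc p q}) :=
  ((convex_bandSet c σ f g).inter ((convex_Icc p q).linear_preimage
    (LinearMap.fst ℝ ℝ ℝ))).isPreconnected

theorem mem_bandSet_of_eq {c σ t y : ℝ} (hσ : σ * σ = 1) {f g : ℝ × ℝ} :
    (c + σ * t, y) ∈ bandSet c σ f g ↔ 0 ≤ t ∧ y ∈ Icc (aff f t) (aff g t) := by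
  have : σ * (c + σ * t - c) = t := by linear_combination t * hσ
  simp only [bandSet, mem_ofPred_eq, this, mem_Icc]

/-- An affine function that is positive on `(0, δ)` grows at least linearly away from `0`. -/
theorem exists_linear_lower_bound {p q : ℝ × ℝ} {δ : ℝ} (hδ : 0 < δ)
    (h : ∀ t ∈ Ioo 0 δ, aff p t < aff q t) :
    ∃ κ > 0, ∀ t ∈ Ioc 0 (δ / 2), aff p t + κ * t ≤ aff q t := by
  have h0 := fst_le_of_aff_le hδ fun t ht => (h t ht).le
  have h1 := h (δ / 2) ⟨by linarith, by linarith⟩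
  -- The chord from `0` to the midpoint has the slope `κ`.
  refine ⟨(aff q (δ / 2) - aff p (δ / 2)) / (δ / 2), div_pos (by linarith) (by linarith),
    fun t ht => ?_⟩
  have h2 : 0 ≤ (q.1 - p.1) * (1 - t / (δ / 2)) := by
    refine mul_nonneg (by linarith) (sub_nonneg.2 ?_)
    rw [div_le_one (by linarith)]
    exact ht.2
  have h3 : aff q t - aff p t - (aff q (δ / 2) - aff p (δ / 2)) / (δ / 2) * t =
      (q.1 - p.1) * (1 - t / (δ / 2)) := by
    unfold aff
    field_simp
    ring
  linarith

/-- On one side of `c`, the set is stacked over windows of radius `2 ε` whose distance from `c` is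
at least a constant multiple of `ε`. -/
theorem HasBands.exists_isStacked {S : Set (ℝ × ℝ)} {c σ δ : ℝ} (hσ : σ = 1 ∨ σ = -1) {n : ℕ}
    {f g : Fin n → ℝ × ℝ} (h : HasBands S c σ δ f g) (hδ : 0 < δ) :
    ∃ ν : ℕ, ∀ ε : ℝ, 0 < ε → ∀ t₀ : ℝ, ν * ε ≤ t₀ → t₀ < δ / 4 →
      IsStacked S n (c + σ * t₀ - 2 * ε) (c + σ * t₀ + 2 * ε) (3 * ε) := by
  have hσσ : σ * σ = 1 := by rcases hσ with rfl | rfl <;> norm_num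
  obtain ⟨L, hL, hfg⟩ := exists_slope_bound f g
  obtain ⟨κ, hκ, hgap⟩ : ∃ κ > 0, ∀ i j, i ≠ j →
      (∀ t ∈ Ioc 0 (δ / 2), aff (g i) t + κ * t ≤ aff (f j) t) ∨
        ∀ t ∈ Ioc 0 (δ / 2), aff (g j) t + κ * t ≤ aff (f i) t := by
    have hev : ∀ p q : ℝ × ℝ, (∀ t ∈ Ioo 0 δ, aff p t < aff q t) → ∀ᶠ κ in 𝓝[>] (0 : ℝ),
        ∀ t ∈ Ioc 0 (δ / 2), aff p t + κ * t ≤ aff q t := by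
      intro p q hpq
      obtain ⟨κ, hκ, hκ'⟩ := exists_linear_lower_bound hδ hpq
      filter_upwards [Ioo_mem_nhdsGT hκ] with κ' h' t ht
      have := mul_le_mul_of_nonneg_right h'.2.le ht.1.le
      linarith [hκ' t ht]
    have : ∀ i j : Fin n, ∀ᶠ κ in 𝓝[>] (0 : ℝ), i ≠ j →
        (∀ t ∈ Ioc 0 (δ / 2), aff (g i) t + κ * t ≤ aff (f j) t) ∨
          ∀ t ∈ Ioc 0 (δ / 2), aff (g j) t + κ * t ≤ aff (f i) t := by
      intro i j
      by_cases hij : i = j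
      · simp [hij]
      rcases h.lt_or_lt i j hij with h | h
      · exact (hev _ _ h).mono fun κ hκ _ => Or.inl hκ
      · exact (hev _ _ h).mono fun κ hκ _ => Or.inr hκ
    obtain ⟨κ, hκ, hκ0⟩ :=
      ((eventually_all.2 fun i => eventually_all.2 (this i)).and self_mem_nhdsWithin).exists
    exact ⟨κ, hκ0, hκ⟩
  obtain ⟨ν, hν⟩ := exists_nat_ge (max 3 (2 + (4 * L + 3) / κ))
  refine ⟨ν, fun ε hε t₀ ht₀ ht₀' => ?_⟩
  have hν3 : 3 * ε ≤ t₀ := le_trans (by gcongr; exact (le_max_left _ _).trans hν) ht₀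
  have hνκ : (2 + (4 * L + 3) / κ) * ε ≤ t₀ :=
    le_trans (by gcongr; exact (le_max_right _ _).trans hν) ht₀
  -- At the near end of the window, the gaps exceed the variation `4 ε L` of the ends by `3 ε`.
  have hκt : (4 * L + 3) * ε ≤ κ * (t₀ - 2 * ε) := by
    have : (2 + (4 * L + 3) / κ) * ε - 2 * ε = (4 * L + 3) * ε / κ := by ring
    rw [mul_comm κ, ← div_le_iff₀ hκ, ← this]
    linarith
  have hwin : ∀ z, z ∈ Icc (c + σ * t₀ - 2 * ε) (c + σ * t₀ + 2 * ε) →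
      ∃ t, z = c + σ * t ∧ t ∈ Icc (t₀ - 2 * ε) (t₀ + 2 * ε) := by
    intro z hz
    refine ⟨σ * (z - c), by linear_combination (-(z - c)) * hσσ, ?_⟩
    rcases hσ with rfl | rfl <;> constructor <;> linarith [hz.1, hz.2]
  have hIoc : ∀ t ∈ Icc (t₀ - 2 * ε) (t₀ + 2 * ε), t ∈ Ioc 0 (δ / 2) := fun t ht =>
    ⟨by linarith [ht.1], by linarith [ht.2]⟩
  have hIoo : ∀ t ∈ Icc (t₀ - 2 * ε) (t₀ + 2 * ε), t ∈ Ioo 0 δ := fun t ht =>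
    ⟨(hIoc t ht).1, by linarith [(hIoc t ht).2]⟩
  refine ⟨fun i => bandSet c σ (f i) (g i) ∩
    {r | r.1 ∈ Icc (c + σ * t₀ - 2 * ε) (c + σ * t₀ + 2 * ε)}, ?_, ?_, ?_⟩
  · rw [← iUnion_inter]
    ext ⟨z, y⟩
    refine and_congr_left fun hz => ?_
    obtain ⟨t, rfl, ht⟩ := hwin z hz
    rw [h.mem_iff t (hIoo t ht), mem_iUnion]
    simp only [mem_bandSet_of_eq hσσ, (hIoc t ht).1.le, true_and]
  · intro i p q hp hpq hq
    rw [inter_strip_inter_strip _ hp hq]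
    refine ⟨?_, isPreconnected_bandSet_inter _ _ _ _ _ _⟩
    obtain ⟨t, ht, ht'⟩ := hwin p ⟨hp, hpq.trans hq⟩
    refine ⟨(p, aff (f i) t), ?_, le_rfl, hpq⟩
    rw [ht, mem_bandSet_of_eq hσσ]
    exact ⟨(hIoc t ht').1.le, le_rfl, h.le t (hIoo t ht') i⟩
  · rintro i j hij ⟨z, y⟩ ⟨hy, hz⟩ ⟨z', y'⟩ ⟨hy', hz'⟩
    obtain ⟨t, rfl, ht⟩ := hwin z hz
    obtain ⟨t', rfl, ht'⟩ := hwin z' hz'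
    rw [mem_bandSet_of_eq hσσ] at hy hy'
    have habs : |t' - t| ≤ 4 * ε := by
      rw [abs_le]
      constructor <;> linarith [ht.1, ht.2, ht'.1, ht'.2]
    have hvar : L * |t' - t| ≤ 4 * L * ε := by nlinarith
    have hκt' : (4 * L + 3) * ε ≤ κ * t := by
      have := mul_le_mul_of_nonneg_left ht.1 hκ.le
      linarith
    have h1 := abs_le.1 ((abs_aff_sub_aff_le (s := t) (t := t') (hfg j).1).trans hvar)
    have h2 := abs_le.1 ((abs_aff_sub_aff_le (s := t) (t := t') (hfg j).2).trans hvar)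
    rw [Real.dist_eq]
    rcases hgap i j hij with h3 | h3
    · rw [abs_sub_comm]
      refine le_trans ?_ (le_abs_self _)
      linarith [h3 t (hIoc t ht), hy.2.2, hy'.2.1]
    · refine le_trans ?_ (le_abs_self _)
      linarith [h3 t (hIoc t ht), hy.2.1, hy'.2.2]

/-- Near a line `x = c` outside the jumping set, a generic set is stacked over all small windows,
including those that contain `c`. -/
theorem IsGenericPLSet.exists_isStacked_of_notMem_jumpingSet {S : Set (ℝ × ℝ)}
    (hS : IsGenericPLSet S) {c : ℝ} (hc : c ∉ jumpingSet S) :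
    ∃ m : ℕ, ∃ δ > 0, ∃ η > 0, ∀ lo hi, c - δ < lo → hi < c + δ → IsStacked S m lo hi η := by
  have hcl := hS.1.isCompact.isClosed
  obtain ⟨m, a, b, hK⟩ := hS.1.exists_hasFiber c
  obtain ⟨f₁, g₁, δ₁, hδ₁, h₁, hl₁⟩ :=
    hS.exists_bands_of_notMem_jumpingSet (Or.inl rfl) hc hK
  obtain ⟨f₂, g₂, δ₂, hδ₂, h₂, hl₂⟩ :=
    hS.exists_bands_of_notMem_jumpingSet (Or.inr rfl) hc hK
  obtain ⟨L₁, hL₁, hs₁⟩ := exists_slope_bound f₁ g₁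
  obtain ⟨L₂, hL₂, hs₂⟩ := exists_slope_bound f₂ g₂
  obtain ⟨η, hη, hgap⟩ := hK.exists_gap
  -- Over this neighbourhood, the bands move by at most `η / 4`.
  have key : ∀ {σ δ L : ℝ} {f g : Fin m → ℝ × ℝ}, 0 < L → (∀ i, |(f i).2| ≤ L ∧ |(g i).2| ≤ L) →
      (∀ k, (f k).1 ∈ Icc (a k) (b k) ∧ (g k).1 ∈ Icc (a k) (b k)) → δ ≤ η / (4 * L) →
      ∀ k, ∀ r ∈ bandSet c σ (f k) (g k), σ * (r.1 - c) < δ →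
        r.2 ∈ Icc (a k - η / 4) (b k + η / 4) := by
    intro σ δ L f g hL hs hl hδ k r hr hrδ
    have h1 : L * |σ * (r.1 - c) - 0| ≤ η / 4 := by
      rw [sub_zero, abs_of_nonneg hr.1]
      have := hrδ.trans_le hδ
      rw [lt_div_iff₀ (by positivity)] at this
      linarith
    have h2 := abs_le.1 ((abs_aff_sub_aff_le (hs k).1).trans h1)
    have h3 := abs_le.1 ((abs_aff_sub_aff_le (hs k).2).trans h1)
    have e : ∀ p : ℝ × ℝ, aff p 0 = p.1 := fun p => by simp [aff]
    rw [e] at h2 h3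
    exact ⟨by linarith [hr.2.1, (hl k).1.1], by linarith [hr.2.2, (hl k).2.2]⟩
  set δ := min (min δ₁ δ₂) (min (η / (4 * L₁)) (η / (4 * L₂)))
  have hδ : 0 < δ := by positivity
  have d1 : δ ≤ δ₁ := (min_le_left _ _).trans (min_le_left _ _)
  have d2 : δ ≤ δ₂ := (min_le_left _ _).trans (min_le_right _ _)
  have d3 : δ ≤ η / (4 * L₁) := (min_le_right _ _).trans (min_le_left _ _)
  have d4 : δ ≤ η / (4 * L₂) := (min_le_right _ _).trans (min_le_right _ _)
  clear_value δ
  replace h₁ := h₁.mono d1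
  replace h₂ := h₂.mono d2
  have hright : ∀ t y k, (c + t, y) ∈ bandSet c 1 (f₁ k) (g₁ k) ↔
      0 ≤ t ∧ y ∈ Icc (aff (f₁ k) t) (aff (g₁ k) t) := fun t y k => by
    have := mem_bandSet_of_eq (c := c) (t := t) (y := y) (f := f₁ k) (g := g₁ k) (σ := 1)
      (by norm_num)
    simpa using this
  have hleft : ∀ t y k, (c - t, y) ∈ bandSet c (-1) (f₂ k) (g₂ k) ↔
      0 ≤ t ∧ y ∈ Icc (aff (f₂ k) t) (aff (g₂ k) t) := fun t y k => by
    have := mem_bandSet_of_eq (c := c) (t := t) (y := y) (f := f₂ k) (g := g₂ k) (σ := -1)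
      (by norm_num)
    simpa [← sub_eq_add_neg] using this
  have e : ∀ p : ℝ × ℝ, aff p 0 = p.1 := fun p => by simp [aff]
  let B : Fin m → Set (ℝ × ℝ) := fun k => {c} ×ˢ Icc (a k) (b k) ∪
    (bandSet c 1 (f₁ k) (g₁ k) ∪ bandSet c (-1) (f₂ k) (g₂ k))
  have hB : ∀ z y, c - δ < z → z < c + δ → ((z, y) ∈ S ↔ ∃ k, (z, y) ∈ B k) := by
    intro z y hz1 hz2
    rcases lt_trichotomy z c with hz | rfl | hz
    · obtain ⟨t, rfl⟩ : ∃ t, z = c - t := ⟨c - z, by ring⟩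
      have ht : 0 < t := by linarith
      have h3 := h₂.mem_iff t ⟨ht, by linarith⟩ y
      rw [neg_one_mul, ← sub_eq_add_neg] at h3
      rw [h3]
      refine exists_congr fun k => ?_
      constructor
      · exact fun h => Or.inr (Or.inr ((hleft t y k).2 ⟨ht.le, h⟩))
      · rintro (h | h | h)
        · have := h.1
          simp only [mem_singleton_iff] at this
          linarith
        · have := h.1
          simp only at this
          linarith
        · exact ((hleft t y k).1 h).2
    · rw [hK.mem_iff]
      refine exists_congr fun k => ?_
      constructor
      · exact fun h => Or.inl ⟨rfl, h⟩
      · rintro (h | h | h)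
        · exact h.2
        · have := ((hright 0 y k).1 (by simpa using h)).2
          rw [e, e] at this
          exact ⟨(hl₁ k).1.1.trans this.1, this.2.trans (hl₁ k).2.2⟩
        · have := ((hleft 0 y k).1 (by simpa using h)).2
          rw [e, e] at this
          exact ⟨(hl₂ k).1.1.trans this.1, this.2.trans (hl₂ k).2.2⟩
    · obtain ⟨t, rfl⟩ : ∃ t, z = c + t := ⟨z - c, by ring⟩
      have ht : 0 < t := by linarith
      have h3 := h₁.mem_iff t ⟨ht, by linarith⟩ y
      rw [one_mul] at h3
      rw [h3]
      refine exists_congr fun k => ?_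
      constructor
      · exact fun h => Or.inr (Or.inl ((hright t y k).2 ⟨ht.le, h⟩))
      · rintro (h | h | h)
        · have := h.1
          simp only [mem_singleton_iff] at this
          linarith
        · exact ((hright t y k).1 h).2
        · have := h.1
          simp only at this
          linarith
  refine ⟨m, δ, hδ, η / 2, by positivity, fun lo hi hlo hhi =>
    ⟨fun k => B k ∩ {r | r.1 ∈ Icc lo hi}, ?_, ?_, ?_⟩⟩
  · rw [← iUnion_inter]
    ext ⟨z, y⟩
    refine and_congr_left fun hz => ?_
    rw [hB z y (hlo.trans_le hz.1) (hz.2.trans_lt hhi), mem_iUnion]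
  · intro k p q hp hpq hq
    have : B k ∩ {r | r.1 ∈ Icc lo hi} ∩ {r | r.1 ∈ Icc p q} =
        ({c} ×ˢ Icc (a k) (b k)) ∩ {r | r.1 ∈ Icc p q} ∪
        (bandSet c 1 (f₁ k) (g₁ k) ∩ {r | r.1 ∈ Icc p q} ∪
          bandSet c (-1) (f₂ k) (g₂ k) ∩ {r | r.1 ∈ Icc p q}) := by
      rw [← union_inter_distrib_right, ← union_inter_distrib_right,
        inter_strip_inter_strip _ hp hq]
    rw [this]
    have hR := isPreconnected_bandSet_inter c 1 (f₁ k) (g₁ k) p q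
    have hL := isPreconnected_bandSet_inter c (-1) (f₂ k) (g₂ k) p q
    by_cases hcp : c < p
    · have e1 : ({c} ×ˢ Icc (a k) (b k)) ∩ {r : ℝ × ℝ | r.1 ∈ Icc p q} = ∅ := by
        ext ⟨z, y⟩
        simp only [mem_inter_iff, mem_prod, mem_singleton_iff, mem_ofPred_eq, mem_Icc,
          mem_empty_iff_false, iff_false]
        rintro ⟨⟨rfl, -⟩, h, -⟩
        linarith
      have e2 : bandSet c (-1) (f₂ k) (g₂ k) ∩ {r | r.1 ∈ Icc p q} = ∅ := by
        ext r
        simp only [mem_inter_iff, mem_ofPred_eq, mem_Icc, mem_empty_iff_false, iff_false]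
        rintro ⟨h, h', -⟩
        linarith [h.1]
      rw [e1, e2, empty_union, union_empty]
      refine ⟨⟨(p, aff (f₁ k) (p - c)), ?_, le_rfl, hpq⟩, hR⟩
      have : (p, aff (f₁ k) (p - c)) = (c + (p - c), aff (f₁ k) (p - c)) := by ring_nf
      rw [this, hright]
      exact ⟨by linarith, le_rfl, h₁.le _ ⟨by linarith, by linarith⟩ k⟩
    by_cases hcq : q < c
    · have e1 : ({c} ×ˢ Icc (a k) (b k)) ∩ {r : ℝ × ℝ | r.1 ∈ Icc p q} = ∅ := by
        ext ⟨z, y⟩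
        simp only [mem_inter_iff, mem_prod, mem_singleton_iff, mem_ofPred_eq, mem_Icc,
          mem_empty_iff_false, iff_false]
        rintro ⟨⟨rfl, -⟩, -, h⟩
        linarith
      have e2 : bandSet c 1 (f₁ k) (g₁ k) ∩ {r | r.1 ∈ Icc p q} = ∅ := by
        ext r
        simp only [mem_inter_iff, mem_ofPred_eq, mem_Icc, mem_empty_iff_false, iff_false]
        rintro ⟨h, -, h'⟩
        linarith [h.1]
      rw [e1, e2, empty_union, empty_union]
      refine ⟨⟨(p, aff (f₂ k) (c - p)), ?_, le_rfl, hpq⟩, hL⟩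
      have : (p, aff (f₂ k) (c - p)) = (c - (c - p), aff (f₂ k) (c - p)) := by ring_nf
      rw [this, hleft]
      exact ⟨by linarith, le_rfl, h₂.le _ ⟨by linarith, by linarith⟩ k⟩
    push Not at hcp hcq
    have hcpq : c ∈ Icc p q := ⟨hcp, hcq⟩
    have hM : ({c} ×ˢ Icc (a k) (b k)) ∩ {r : ℝ × ℝ | r.1 ∈ Icc p q} = {c} ×ˢ Icc (a k) (b k) := by
      rw [inter_eq_left]
      rintro ⟨z, y⟩ ⟨hz, -⟩
      obtain rfl : z = c := hz
      exact hcpq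
    rw [hM, ← union_assoc]
    refine ⟨⟨(c, a k), Or.inl (Or.inl ⟨rfl, le_rfl, hK.le k⟩)⟩, ?_⟩
    have hMc : IsPreconnected ({c} ×ˢ Icc (a k) (b k)) :=
      isPreconnected_singleton.prod isPreconnected_Icc
    have m1 : (c, (f₁ k).1) ∈ bandSet c 1 (f₁ k) (g₁ k) := by
      have := (hright 0 (f₁ k).1 k).2
      rw [e, e, add_zero] at this
      exact this ⟨le_rfl, le_rfl, fst_le_of_aff_le hδ fun t ht => h₁.le t ht k⟩
    have m2 : (c, (f₂ k).1) ∈ bandSet c (-1) (f₂ k) (g₂ k) := by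
      have := (hleft 0 (f₂ k).1 k).2
      rw [e, e, sub_zero] at this
      exact this ⟨le_rfl, le_rfl, fst_le_of_aff_le hδ fun t ht => h₂.le t ht k⟩
    have n1 : (c, (f₁ k).1) ∈ ({c} ×ˢ Icc (a k) (b k) : Set (ℝ × ℝ)) := ⟨rfl, (hl₁ k).1⟩
    have n2 : (c, (f₂ k).1) ∈ ({c} ×ˢ Icc (a k) (b k) : Set (ℝ × ℝ)) := ⟨rfl, (hl₂ k).1⟩
    replace m1 : (c, (f₁ k).1) ∈ bandSet c 1 (f₁ k) (g₁ k) ∩ {r | r.1 ∈ Icc p q} := ⟨m1, hcpq⟩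
    replace m2 : (c, (f₂ k).1) ∈ bandSet c (-1) (f₂ k) (g₂ k) ∩ {r | r.1 ∈ Icc p q} := ⟨m2, hcpq⟩
    exact IsPreconnected.union _ (Or.inl n2) m2 (IsPreconnected.union _ n1 m1 hMc hR) hL
  · have hheight : ∀ k, ∀ r ∈ B k ∩ {r | r.1 ∈ Icc lo hi},
        r.2 ∈ Icc (a k - η / 4) (b k + η / 4) := by
      rintro k r ⟨hr | hr | hr, hlh⟩
      · exact ⟨by linarith [hr.2.1], by linarith [hr.2.2]⟩
      · exact key hL₁ hs₁ hl₁ d3 k r hr (by linarith [hlh.2])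
      · exact key hL₂ hs₂ hl₂ d4 k r hr (by linarith [hlh.1])
    intro k l hkl r hr r' hr'
    have h3 := hheight k r hr
    have h4 := hheight l r' hr'
    rw [Real.dist_eq]
    rcases hgap k l hkl with h5 | h5
    · rw [abs_sub_comm]
      exact le_trans (by linarith [h3.2, h4.1]) (le_abs_self _)
    · exact le_trans (by linarith [h3.1, h4.2]) (le_abs_self _)

/-! ### Uniformity -/

theorem IsStacked.mono_gap {S : Set (ℝ × ℝ)} {m : ℕ} {lo hi η η' : ℝ}
    (h : IsStacked S m lo hi η) (hη : η' ≤ η) : IsStacked S m lo hi η' := by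
  obtain ⟨B, hB, hc, hs⟩ := h
  exact ⟨B, hB, hc, fun i j hij p hp q hq => hη.trans (hs i j hij p hp q hq)⟩

/-- With uniform constants, `S` is stacked with gaps `3 ε` over the windows of radius `2 ε` around
those points of `X` whose distance from the jumping set is at least `ν ε`. -/
def IsUniformlyStacked (S : Set (ℝ × ℝ)) (X : Set ℝ) : Prop :=
  ∃ ν : ℕ, ∃ ε₀ > (0 : ℝ), ∀ ε : ℝ, 0 < ε → ε < ε₀ → ∀ x ∈ X,
    ENNReal.ofReal (ν * ε) ≤ Metric.infEDist x (jumpingSet S) →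
      ∃ m, IsStacked S m (x - 2 * ε) (x + 2 * ε) (3 * ε)

theorem IsUniformlyStacked.union {S : Set (ℝ × ℝ)} {X Y : Set ℝ} (hX : IsUniformlyStacked S X)
    (hY : IsUniformlyStacked S Y) : IsUniformlyStacked S (X ∪ Y) := by
  obtain ⟨ν, ε₀, hε₀, h⟩ := hX
  obtain ⟨ν', ε₀', hε₀', h'⟩ := hY
  refine ⟨max ν ν', min ε₀ ε₀', lt_min hε₀ hε₀', fun ε hε hε' x hx hd => ?_⟩
  rcases hx with hx | hx
  · refine h ε hε (hε'.trans_le (min_le_left _ _)) x hx (le_trans ?_ hd)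
    gcongr
    exact le_max_left _ _
  · refine h' ε hε (hε'.trans_le (min_le_right _ _)) x hx (le_trans ?_ hd)
    gcongr
    exact le_max_right _ _

theorem IsGenericPLSet.exists_ball_isUniformlyStacked {S : Set (ℝ × ℝ)} (hS : IsGenericPLSet S)
    (c : ℝ) : ∃ δ > 0, IsUniformlyStacked S (Metric.ball c δ) := by
  by_cases hc : c ∈ jumpingSet S
  · obtain ⟨n, f, g, δ, hδ, h⟩ := hS.1.exists_hasBands c 1
    obtain ⟨n', f', g', δ', hδ', h'⟩ := hS.1.exists_hasBands c (-1)
    obtain ⟨ν, hν⟩ := h.exists_isStacked (Or.inl rfl) hδ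
    obtain ⟨ν', hν'⟩ := h'.exists_isStacked (Or.inr rfl) hδ'
    refine ⟨min (δ / 4) (δ' / 4), by positivity, max ν ν', 1, one_pos,
      fun ε hε _ x hx hd => ?_⟩
    have hd' : ((max ν ν' : ℕ) : ℝ) * ε ≤ |x - c| := by
      have := hd.trans (Metric.infEDist_le_edist_of_mem hc)
      rw [edist_dist, ENNReal.ofReal_le_ofReal_iff dist_nonneg, Real.dist_eq] at this
      exact this
    have hx' : |x - c| < min (δ / 4) (δ' / 4) := by rwa [Metric.mem_ball, Real.dist_eq] at hx
    have hle : (ν : ℝ) * ε ≤ (max ν ν' : ℕ) * ε := by gcongr; exact le_max_left _ _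
    have hle' : (ν' : ℝ) * ε ≤ (max ν ν' : ℕ) * ε := by gcongr; exact le_max_right _ _
    rcases le_total c x with hcx | hcx
    · rw [abs_of_nonneg (by linarith)] at hd' hx'
      have := hν ε hε (x - c) (by linarith) (hx'.trans_le (min_le_left _ _))
      rw [one_mul, add_sub_cancel] at this
      exact ⟨_, this⟩
    · rw [abs_of_nonpos (by linarith)] at hd' hx'
      have := hν' ε hε (-(x - c)) (by linarith) (hx'.trans_le (min_le_right _ _))
      rw [neg_one_mul, neg_neg, add_sub_cancel] at this
      exact ⟨_, this⟩
  · obtain ⟨m, δ, hδ, η, hη, h⟩ := hS.exists_isStacked_of_notMem_jumpingSet hc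
    refine ⟨δ / 2, by positivity, 0, min (δ / 4) (η / 3), by positivity,
      fun ε hε hε' x hx _ => ⟨m, ?_⟩⟩
    have h1 := hε'.trans_le (min_le_left _ _)
    have h2 := hε'.trans_le (min_le_right _ _)
    rw [Metric.mem_ball, Real.dist_eq, abs_lt] at hx
    exact (h _ _ (by linarith) (by linarith)).mono_gap (by linarith)

theorem IsGenericPLSet.isUniformlyStacked_univ {S : Set (ℝ × ℝ)} (hS : IsGenericPLSet S) :
    IsUniformlyStacked S univ := by
  obtain ⟨R, hR⟩ := hS.1.isCompact.isBounded.exists_norm_le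
  have hin : IsUniformlyStacked S (Icc (-R - 1) (R + 1)) := by
    refine isCompact_Icc.induction_on (p := IsUniformlyStacked S) ?_ ?_ ?_ ?_
    · exact ⟨0, 1, one_pos, fun _ _ _ _ hx => hx.elim⟩
    · rintro X Y hXY ⟨ν, ε₀, hε₀, h⟩
      exact ⟨ν, ε₀, hε₀, fun ε h1 h2 x hx => h ε h1 h2 x (hXY hx)⟩
    · exact fun X Y => IsUniformlyStacked.union
    · intro c _
      obtain ⟨δ, hδ, h⟩ := hS.exists_ball_isUniformlyStacked c
      exact ⟨_, mem_nhdsWithin_of_mem_nhds (Metric.ball_mem_nhds c hδ), h⟩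
  have hout : IsUniformlyStacked S (Icc (-R - 1) (R + 1))ᶜ := by
    refine ⟨0, 1 / 2, by norm_num, fun ε hε hε' x hx _ => ⟨0, fun i => i.elim0, ?_,
      fun i => i.elim0, fun i => i.elim0⟩⟩
    rw [iUnion_of_empty]
    ext r
    simp only [mem_inter_iff, mem_ofPred_eq, mem_empty_iff_false, iff_false]
    rintro ⟨hrS, hr1, hr2⟩
    have := abs_le.1 ((norm_fst_le r).trans (hR r hrS))
    exact hx ⟨by linarith, by linarith⟩
  rw [← union_compl_self (Icc (-R - 1) (R + 1))]
  exact hin.union hout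

theorem mainTheorem2 (S : Set (ℝ × ℝ)) (hS : IsGenericPLSet S) :
    ∃ ν : ℕ, 0 < ν ∧ ∃ ε₀ : ℝ, 0 < ε₀ ∧
      ∀ ε : ℝ, 0 < ε → ε < ε₀ → ∀ x : ℝ, IsEpsGeneric ε x →
        ENNReal.ofReal (ν * ε) ≤ Metric.infEDist x (jumpingSet S) →
          stackCounter ε S x = componentCounter S x ∧
            pixelStackCounter ε S x = componentCounter S x := by
  obtain ⟨ν, ε₀, hε₀, h⟩ := hS.isUniformlyStacked_univ
  refine ⟨ν + 1, ν.succ_pos, ε₀, hε₀, fun ε hε hε' x hx hd => ?_⟩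
  obtain ⟨m, hm⟩ := h ε hε hε' x (mem_univ x) (le_trans (by gcongr; simp) hd)
  have hc : componentCounter S x = m :=
    (hm.mono (lo' := x) (hi' := x) (by linarith) (by linarith)).componentCounter_eq (by positivity)
  rw [stackCounter_eq hε hx hm, pixelStackCounter_eq hε hx hm, hc]
  exact ⟨rfl, rfl⟩
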